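/- **Lemma 4.6 (Discrete coercivity).** Let $\Omega\subset\mathbb R^3$ be open, bounded and contractible. For matrix fields $\sigma:\Omega\to\mathbb R^{3\times3}$ let $(\nabla\cdot\sigma)_i=\sum_j\partial_j\sigma_{ij}$ (weak divergence), $(S\sigma)_i=\sigma_{i-1,i+1}-\sigma_{i+1,i-1}$ (indices modulo 3), and let $(\cdot,\cdot)$, $\|\cdot\|$ be the $L^2(\Omega)$ inner product and norm. *Material.* Let $A_\sigma,\tilde A_\omega$ be fields of linear maps $\mathbb R^{3\times 3}\to\mathbb R^{3\times 3}$ on $\Omega$, acting pointwise on $L^2$ matrix fields, pointwise symmetric positive definite, with $(A_\sigma\sigma,\sigma)\ge A_\sigma^-\|\sigma\|^2$, $(A_\sigma\sigma,\tau)\le A_\sigma^+\|\sigma\|\|\tau\|$, and likewise $(\tilde A_\omega\omega,\omega)\ge A_\omega^-\|\omega\|^2$, $(\tilde A_\omega\omega,\rho)\le A_\omega^+\|\omega\|\|\rho\|$, for all $L^2$ matrix fields, where $A_\sigma^-,A_\omega^->0$ and $A_\sigma^+,A_\omega^+<\infty$. Let $\Theta_H$ be a non-overlapping partitioning of $\Omega$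 and let $\ell$ be continuous on $\Omega$ and affine on each cell of $\Theta_H$, with $0\le\ell\le1$ and $|\nabla\ell|\le C_\ell$ almost everywhere. *Spaces.* Let $\Omega_h$ be a simplicial tessellation of $\Omega$ that resolves $\Theta_H$ (each simplex lies in one cell). For $k\ge0$ let $P_{-k}(\Omega_h)$ be the functions that are polynomials of degree at most $k$ on each simplex, $BDM_{k}=P_{-k}(\Omega_h)^3\cap H(\nabla\cdot)$ and $RT_k=(P_{-k}(\Omega_h)^3\oplus\hat P_{-k}(\Omega_h)\,x)\cap H(\nabla\cdot)$, with $\hat P_{-k}$ the piecewise homogeneous polynomials of degree $k$. Put $$X^{p}_{h,k}=BDM_{k+1}^3\times W_k^3,\quad W_k\in\{BDM_{k+1},RT_k\},\qquad X^{u}_{h,k}=P_{-k}(\Omega_h)^3\times P_{-k}(\Omega_h)^3,$$ where the third powers in $X^p_{h,k}$ mean that the rows of the matrix fields lie in the given space. Let $H_\ell\mathcal M$ be the space of pairs $p=(\sigma,\omega)$ of $L^2$ matrix fields with $\nabla\cdot\sigma\in L^2$ and $\nabla\cdot(\ell\omega)\in L^2$, with $$\|p\|_{H_\ell\mathcal M}^2=\|\sigma\|^2+\|\nabla\cdot\sigma\|^2+\|\omega\|^2+\|\nabla\cdot(\ell\omega)\|^2,$$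 and let $(\tilde{\mathcal A}p,p)=(A_\sigma\sigma,\sigma)+(\tilde A_\omega\omega,\omega)$ and $\mathcal S_\ell p=(-\nabla\cdot\sigma,\;S\sigma-\nabla\cdot(\ell\omega))$. *Claim.* $X^p_{h,k}\subset H_\ell\mathcal M$ and $X^u_{h,k}\subset L^2(\Omega)^3\times L^2(\Omega)^3$, and there is a constant $C>0$ depending only on $k$ and $C_\ell$ (in particular not on $\ell$ itself, on the mesh, on $\Omega$, or on the material tensors) such that every $p\in X^p_{h,k}$ with $(\mathcal S_\ell p,u)=0$ for all $u\in X^u_{h,k}$ satisfies $$(\tilde{\mathcal A}p,p)\;\ge\;C\,\min(A_\sigma^-,A_\omega^-)\,\|p\|_{H_\ell\mathcal M}^2 .$$ -/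

import Mathlib

open MeasureTheory Set TopologicalSpace
open scoped Distributions

noncomputable section

namespace Cosserat

/-- Three-dimensional Euclidean space. -/
abbrev R3 : Type := EuclideanSpace ℝ (Fin 3)

/-- Real 3 × 3 matrices. -/
abbrev Mat : Type := Matrix (Fin 3) (Fin 3) ℝ

/-! ### Square integrable fields and weak divergences -/

/-- Square integrable vector fields `L²𝕍` on `Ω`. -/
def L2V (Ω : Set R3) : Set (R3 → Fin 3 → ℝ) :=
  {v | ∀ i, MemLp (fun x => v x i) 2 (volume.restrict Ω)}

/-- Square integrable matrix fields `L²𝕄` on `Ω`. -/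
def L2M (Ω : Set R3) : Set (R3 → Mat) :=
  {σ | ∀ i j, MemLp (fun x => σ x i j) 2 (volume.restrict Ω)}

/-- The `L²` inner product of vector fields. -/
def innerV (Ω : Set R3) (u v : R3 → Fin 3 → ℝ) : ℝ :=
  ∫ x in Ω, ∑ i, u x i * v x i

/-- The `L²` inner product of matrix fields, `∫ σ : τ`. -/
def innerM (Ω : Set R3) (σ τ : R3 → Mat) : ℝ :=
  ∫ x in Ω, ∑ i, ∑ j, σ x i j * τ x i j

/-- The partial derivative `∂φ/∂x_j`. -/
def partialDeriv (j : Fin 3) (φ : R3 → ℝ) (x : R3) : ℝ :=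
  fderiv ℝ φ x (EuclideanSpace.single j 1)

/-- `d` is a weak divergence of the vector field `v` on `Ω`. -/
def IsWeakDiv (Ω : Opens R3) (v : R3 → Fin 3 → ℝ) (d : R3 → ℝ) : Prop :=
  ∀ φ : 𝓓(Ω, ℝ),
    ∫ x in (Ω : Set R3), ∑ j, v x j * partialDeriv j φ x = - ∫ x in (Ω : Set R3), d x * φ x

/-- The space `H(∇·; Ω)` of square integrable vector fields with square integrable weak
divergence. -/
def HDiv (Ω : Opens R3) : Set (R3 → Fin 3 → ℝ) :=
  {v | v ∈ L2V Ω ∧ ∃ d : R3 → ℝ, MemLp d 2 (volume.restrict (Ω : Set R3)) ∧ IsWeakDiv Ω v d}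

open scoped Classical in
/-- The weak divergence of a vector field in `H(∇·; Ω)`; it is determined up to equality almost
everywhere in `Ω`. (Outside `H(∇·; Ω)` the value is `0` by convention.) -/
def weakDiv (Ω : Opens R3) (v : R3 → Fin 3 → ℝ) : R3 → ℝ :=
  if h : ∃ d : R3 → ℝ, MemLp d 2 (volume.restrict (Ω : Set R3)) ∧ IsWeakDiv Ω v d
  then h.choose else 0

/-- The space `H(∇·; 𝕄)` of matrix fields all of whose rows are in `H(∇·; Ω)`. -/
def HDivM (Ω : Opens R3) : Set (R3 → Mat) :=
  {σ | ∀ i, (fun x => σ x i) ∈ HDiv Ω}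

/-- The row-wise weak divergence `(∇·σ)_i = ∑_j ∂σ_ij/∂x_j` of a matrix field. -/
def divM (Ω : Opens R3) (σ : R3 → Mat) : R3 → Fin 3 → ℝ :=
  fun x i => weakDiv Ω (fun y => σ y i) x

/-- The product `ℓ ω` of a scalar field and a matrix field. -/
def scale (ℓ : R3 → ℝ) (ω : R3 → Mat) : R3 → Mat := fun x => ℓ x • ω x

/-- The weighted space `H(∇·ℓ; 𝕄)`. -/
def HDivWeighted (Ω : Opens R3) (ℓ : R3 → ℝ) : Set (R3 → Mat) :=
  {ω | ω ∈ L2M Ω ∧ scale ℓ ω ∈ HDivM Ω}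

/-- The space `H_ℓ𝓜 = H(∇·; 𝕄) × H(∇·ℓ; 𝕄)`. -/
def HlM (Ω : Opens R3) (ℓ : R3 → ℝ) : Set ((R3 → Mat) × (R3 → Mat)) :=
  HDivM Ω ×ˢ HDivWeighted Ω ℓ

/-- The square of the norm of `H_ℓ𝓜`:
`‖(σ, ω)‖² = ‖σ‖² + ‖∇·σ‖² + ‖ω‖² + ‖∇·(ℓω)‖²`. -/
def normSqHlM (Ω : Opens R3) (ℓ : R3 → ℝ) (p : (R3 → Mat) × (R3 → Mat)) : ℝ :=
  (innerM Ω p.1 p.1 + innerV Ω (divM Ω p.1) (divM Ω p.1)) +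
  (innerM Ω p.2 p.2 + innerV Ω (divM Ω (scale ℓ p.2)) (divM Ω (scale ℓ p.2)))

/-! ### Material tensors and the operators of the scaled Cosserat system -/

/-- The asymmetry operator `(Sσ)_i = σ_{i-1,i+1} - σ_{i+1,i-1}`, indices modulo 3. -/
def asym (σ : Mat) : Fin 3 → ℝ := fun i => σ (i - 1) (i + 1) - σ (i + 1) (i - 1)

/-- A field of four-tensors, acting pointwise on matrix fields. -/
abbrev FourTensorField : Type := R3 → (Mat →ₗ[ℝ] Mat)

/-- The matrix field `Aσ`. -/
def FourTensorField.app (A : FourTensorField) (σ : R3 → Mat) : R3 → Mat := fun x => A x (σ x)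

/-- `A` is a material tensor on `Ω` with lower bound `lo` and upper bound `hi`: it acts on `L²𝕄`,
is pointwise symmetric positive definite, and is uniformly bounded from below and above. -/
structure IsMaterialTensor (Ω : Set R3) (A : FourTensorField) (lo hi : ℝ) : Prop where
  mapsTo : ∀ σ ∈ L2M Ω, A.app σ ∈ L2M Ω
  pointwise_symm : ∀ᵐ x ∂volume.restrict Ω, ∀ m n : Mat,
    ∑ i, ∑ j, A x m i j * n i j = ∑ i, ∑ j, A x n i j * m i j
  pointwise_pos : ∀ᵐ x ∂volume.restrict Ω, ∀ m : Mat, m ≠ 0 → 0 < ∑ i, ∑ j, A x m i j * m i j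
  symm : ∀ σ ∈ L2M Ω, ∀ τ ∈ L2M Ω, innerM Ω (A.app σ) τ = innerM Ω (A.app τ) σ
  lo_pos : 0 < lo
  lower : ∀ σ ∈ L2M Ω, lo * innerM Ω σ σ ≤ innerM Ω (A.app σ) σ
  upper : ∀ σ ∈ L2M Ω, ∀ τ ∈ L2M Ω,
    innerM Ω (A.app σ) τ ≤ hi * (√(innerM Ω σ σ) * √(innerM Ω τ τ))

/-- The bilinear form `(𝒜̃ p, r) = (A_σ σ, τ) + (Ã_ω ω, ρ)` for `p = (σ, ω)`, `r = (τ, ρ)`. -/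
def formA (Ω : Set R3) (Aσ Aω : FourTensorField) (p r : (R3 → Mat) × (R3 → Mat)) : ℝ :=
  innerM Ω (Aσ.app p.1) r.1 + innerM Ω (Aω.app p.2) r.2

/-- The operator `S_ℓ (σ, ω) = (-∇·σ, Sσ - ∇·(ℓω))`. -/
def opS (Ω : Opens R3) (ℓ : R3 → ℝ) (p : (R3 → Mat) × (R3 → Mat)) :
    (R3 → Fin 3 → ℝ) × (R3 → Fin 3 → ℝ) :=
  (fun x => - divM Ω p.1 x, fun x => asym (p.1 x) - divM Ω (scale ℓ p.2) x)

/-- The bilinear form `(S_ℓ p, u)` for `u = (u, r)`. -/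
def formS (Ω : Opens R3) (ℓ : R3 → ℝ) (p : (R3 → Mat) × (R3 → Mat))
    (u : (R3 → Fin 3 → ℝ) × (R3 → Fin 3 → ℝ)) : ℝ :=
  innerV Ω (opS Ω ℓ p).1 u.1 + innerV Ω (opS Ω ℓ p).2 u.2

/-! ### Partitions, meshes and piecewise polynomials -/

/-- `Θ` is a non-overlapping partitioning of `Ω` into open cells. -/
structure IsPartition (Ω : Set R3) (Θ : Set (Set R3)) : Prop where
  isOpen : ∀ T ∈ Θ, IsOpen T
  subset : ∀ T ∈ Θ, T ⊆ Ω
  disjoint : Θ.PairwiseDisjoint id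
  ae_cover : ∀ᵐ x ∂volume.restrict Ω, x ∈ ⋃₀ Θ

/-- A (finite, geometrically conforming) simplicial tessellation of `Ω`: a simplicial complex all
of whose faces are faces of tetrahedra, with open tetrahedra inside `Ω`, and filling the closure
of `Ω`. -/
structure SimplicialMesh (Ω : Set R3) extends Geometry.SimplicialComplex ℝ R3 where
  finite_faces : faces.Finite
  pure : ∀ s ∈ faces, ∃ t ∈ faces, s ⊆ t ∧ t.card = 4
  interior_subset : ∀ t ∈ faces, t.card = 4 → interior (convexHull ℝ (t : Set R3)) ⊆ Ω
  space_eq : (⋃ t ∈ faces, convexHull ℝ (t : Set R3)) = closure Ω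

/-- The open 3-simplices of a mesh. -/
def SimplicialMesh.cells {Ω : Set R3} (M : SimplicialMesh Ω) : Set (Set R3) :=
  {T | ∃ t ∈ M.faces, t.card = 4 ∧ T = interior (convexHull ℝ (t : Set R3))}

/-- The mesh `M` resolves the partitioning `Θ`. -/
def SimplicialMesh.Resolves {Ω : Set R3} (M : SimplicialMesh Ω) (Θ : Set (Set R3)) : Prop :=
  ∀ T ∈ M.cells, ∃ U ∈ Θ, T ⊆ U

/-- `P_{-k}(𝒯)`: scalar functions which on each cell of `𝒯` are (almost everywhere equal to) a
polynomial of total degree at most `k`. -/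
def brokenPoly (k : ℕ) (𝒯 : Set (Set R3)) : Set (R3 → ℝ) :=
  {f | ∀ T ∈ 𝒯, ∃ p : MvPolynomial (Fin 3) ℝ, p.totalDegree ≤ k ∧
    ∀ᵐ x ∂volume.restrict T, f x = MvPolynomial.eval (fun i => x i) p}

/-- `P_k(𝒯)`: the functions of `P_{-k}(𝒯)` that are continuous on `Ω`. -/
def contPoly (Ω : Set R3) (k : ℕ) (𝒯 : Set (Set R3)) : Set (R3 → ℝ) :=
  {f | f ∈ brokenPoly k 𝒯 ∧ ContinuousOn f Ω}

/-- `P_{-k}(𝒯)³`. -/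
def brokenPolyV (k : ℕ) (𝒯 : Set (Set R3)) : Set (R3 → Fin 3 → ℝ) :=
  {v | ∀ i, (fun x => v x i) ∈ brokenPoly k 𝒯}

/-- The Brezzi-Douglas-Marini space `BDM_k = P_{-k}³ ∩ H(∇·)`. -/
def BDM {Ω : Opens R3} (k : ℕ) (M : SimplicialMesh (Ω : Set R3)) : Set (R3 → Fin 3 → ℝ) :=
  brokenPolyV k M.cells ∩ HDiv Ω

/-- The Raviart-Thomas space `RT_k = (P_{-k}³ ⊕ P̂_{-k} x) ∩ H(∇·)`, where on each simplex `P̂_{-k}`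
consists of the homogeneous polynomials of degree `k`. -/
def RT {Ω : Opens R3} (k : ℕ) (M : SimplicialMesh (Ω : Set R3)) : Set (R3 → Fin 3 → ℝ) :=
  {v | ∀ T ∈ M.cells, ∃ (p : Fin 3 → MvPolynomial (Fin 3) ℝ) (q : MvPolynomial (Fin 3) ℝ),
    (∀ i, (p i).totalDegree ≤ k) ∧ q.IsHomogeneous k ∧
    ∀ᵐ x ∂volume.restrict T, ∀ i,
      v x i = MvPolynomial.eval (fun i => x i) (p i) +
        MvPolynomial.eval (fun i => x i) q * x i} ∩ HDiv Ω

/-- `W³`: the matrix fields with rows in `W`. -/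
def rows (W : Set (R3 → Fin 3 → ℝ)) : Set (R3 → Mat) := {σ | ∀ i, (fun x => σ x i) ∈ W}

/-- The stress space `BDM_{k+1}³ × W³`. -/
def Xp {Ω : Opens R3} (k : ℕ) (M : SimplicialMesh (Ω : Set R3)) (W : Set (R3 → Fin 3 → ℝ)) :
    Set ((R3 → Mat) × (R3 → Mat)) :=
  rows (BDM (k + 1) M) ×ˢ rows W

/-- The displacement-rotation space `P_{-k}³ × P_{-k}³`. -/
def Xu {Ω : Set R3} (k : ℕ) (M : SimplicialMesh Ω) :
    Set ((R3 → Fin 3 → ℝ) × (R3 → Fin 3 → ℝ)) :=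
  brokenPolyV k M.cells ×ˢ brokenPolyV k M.cells

/-- The discrete kernel of `S_ℓ`: those `p ∈ X^p` with `(S_ℓ p, u) = 0` for all `u ∈ X^u`. -/
def discreteKernel {Ω : Opens R3} (ℓ : R3 → ℝ) (k : ℕ) (M : SimplicialMesh (Ω : Set R3))
    (W : Set (R3 → Fin 3 → ℝ)) : Set ((R3 → Mat) × (R3 → Mat)) :=
  {p | p ∈ Xp k M W ∧ ∀ u ∈ Xu k M, formS Ω ℓ p u = 0}

/-- The length-scale function: continuous and piecewise linear on `Θ`, with values in `[0, 1]` and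
gradient bounded by `Cl` almost everywhere. -/
structure IsLengthScale (Ω : Set R3) (Θ : Set (Set R3)) (ℓ : R3 → ℝ) (Cl : ℝ) : Prop where
  mem : ℓ ∈ contPoly Ω 1 Θ
  bounds : ∀ᵐ x ∂volume.restrict Ω, 0 ≤ ℓ x ∧ ℓ x ≤ 1
  gradient_le : ∀ᵐ x ∂volume.restrict Ω, ‖gradient ℓ x‖ ≤ Cl

end Cosserat

end

/-!
Let `p = (σ, ω)` lie in the discrete kernel. Testing with `∇·σ`, which is piecewise polynomial of
degree at most `k`, gives `∇·σ = 0`, so only `‖∇·(ℓω)‖` has to be bounded by `‖σ‖` and `‖ω‖`.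

Since `ℓ` is locally Lipschitz, `∇·(ℓω) = ℓ ∇·ω + (∇ℓ)·ω`, and the kernel condition says that
`(ℓ ∇·ω, r) = (Sσ - (∇ℓ)·ω, r)` for piecewise polynomial `r`. The natural test field `ℓ ∇·ω` has
too high a degree; instead, replace `ℓ` on each simplex by its largest vertex value `μ ≥ ℓ` and take
`r = μ ∇·ω`. On a simplex `T` the affine function `ℓ` is a combination, with coefficients its vertex
values, of the barycentric coordinates `λ_i`. The inequality `∫_T q² ≤ C ∫_T λ_i q²` for polynomials
`q` of degree at most `k` follows on one simplex from the equivalence of norms in finite dimension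
and carries over to all simplices with the same constant, because an affine change of variables
multiplies both sides by the same determinant. Hence `‖μ ∇·ω‖² ≤ C (ℓ ∇·ω, μ ∇·ω)`, with `C`
independent of the shapes of the simplices, and `‖ℓ ∇·ω‖ ≤ ‖μ ∇·ω‖ ≤ C ‖Sσ - (∇ℓ)·ω‖`.
-/

noncomputable section

open Filter Metric Topology
open scoped NNReal

namespace Cosserat

/-! ### Locally Lipschitz functions -/

section Lipschitz

variable {E F : Type*} [NormedAddCommGroup E] [NormedAddCommGroup F]

theorem locallyLipschitz_mul_of_tsupport_subset {U : Set E} (hU : IsOpen U) {f g : E → ℝ}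
    (hf : LocallyLipschitzOn U f) (hg : LocallyLipschitz g) (hs : tsupport g ⊆ U) :
    LocallyLipschitz fun x => f x * g x := by
  intro x
  by_cases hx : x ∈ tsupport g
  · obtain ⟨Lf, t, ht, hft⟩ := hf (hs hx)
    obtain ⟨Lg, t', ht', hgt'⟩ := hg x
    obtain ⟨Lm, u, hu, hmu⟩ := (contDiff_mul (𝕜 := ℝ) (𝔸 := ℝ) (n := 1)).locallyLipschitz
      (f x, g x)
    rw [hU.nhdsWithin_eq (hs hx)] at ht
    have hpair : ContinuousAt (fun y => (f y, g y)) x :=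
      (hft.continuousOn.continuousAt ht).prodMk (hgt'.continuousOn.continuousAt ht')
    exact ⟨_, _, inter_mem (inter_mem ht ht') (hpair hu), hmu.comp
      ((hft.mono fun _ h => h.1.1).prodMk (hgt'.mono fun _ h => h.1.2)) fun _ h => h.2⟩
  · refine ⟨0, {y | g y = 0}, notMem_tsupport_iff_eventuallyEq.1 hx, fun y hy z hz => ?_⟩
    simp_all only [mem_ofPred_eq, mul_zero, edist_self, zero_le]

theorem continuousOn_of_eventually_norm_sub_le {s : Set E} {f : E → F} {L : ℝ≥0}
    (h : ∀ x ∈ s, ∀ᶠ z in 𝓝[s] x, ‖f z - f x‖ ≤ L * ‖z - x‖) : ContinuousOn f s := by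
  refine fun x hx => tendsto_iff_norm_sub_tendsto_zero.2 (squeeze_zero'
    (Eventually.of_forall fun _ => norm_nonneg _) (h x hx)
    (tendsto_nhdsWithin_of_tendsto_nhds ?_))
  have hcont : Continuous fun z : E => (L : ℝ) * ‖z - x‖ := by fun_prop
  simpa only [sub_self, norm_zero, mul_zero] using hcont.tendsto x

variable [NormedSpace ℝ E]

theorem lipschitzOnWith_of_eventually_norm_sub_le {s : Set E} (hs : Convex ℝ s) {f : E → F}
    {L : ℝ≥0} (h : ∀ x ∈ s, ∀ᶠ z in 𝓝[s] x, ‖f z - f x‖ ≤ L * ‖z - x‖) :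
    LipschitzOnWith L f s := by
  refine LipschitzOnWith.of_dist_le_mul fun y hy x hx => ?_
  rw [dist_eq_norm, dist_eq_norm]
  refine le_of_forall_pos_le_add fun ε hε => ?_
  have hmaps : MapsTo (fun t : ℝ => x + t • (y - x)) (Icc 0 1) s :=
    fun t ht => hs.add_smul_sub_mem hx hy ht
  have hgrowth := image_norm_le_of_liminf_right_slope_norm_lt_deriv_boundary (a := 0) (b := 1)
    (f := fun t : ℝ => f (x + t • (y - x)) - f x) (f' := fun _ => L * ‖y - x‖)
    (B := fun t => (L * ‖y - x‖ + ε) * t) (B' := fun _ => L * ‖y - x‖ + ε)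
    (((continuousOn_of_eventually_norm_sub_le h).comp (by fun_prop) hmaps).sub
      continuousOn_const) ?_ (by simp) (by fun_prop)
    (fun t _ => by simpa using ((hasDerivAt_id t).const_mul (L * ‖y - x‖ + ε)).hasDerivWithinAt)
    (fun t _ _ => by linarith)
  · simpa using hgrowth (right_mem_Icc.2 zero_le_one)
  · intro t ht r hr
    have hline : Tendsto (fun z : ℝ => x + z • (y - x)) (𝓝[>] t) (𝓝[s] (x + t • (y - x))) := by
      refine tendsto_nhdsWithin_iff.2 ⟨(Continuous.tendsto (by fun_prop) t).mono_left
        nhdsWithin_le_nhds, ?_⟩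
      filter_upwards [Ioc_mem_nhdsGT ht.2] with z hz
      exact hmaps ⟨ht.1.trans hz.1.le, hz.2⟩
    refine Eventually.frequently ?_
    filter_upwards [hline.eventually (h _ (hmaps (Ico_subset_Icc_self ht))), self_mem_nhdsWithin]
      with z hz htz
    have htz : 0 < z - t := sub_pos.2 htz
    refine lt_of_le_of_lt ?_ hr
    have hstep : x + z • (y - x) - (x + t • (y - x)) = (z - t) • (y - x) := by module
    rw [hstep, norm_smul, Real.norm_eq_abs, abs_of_pos htz] at hz
    have hdiff := norm_sub_norm_le (f (x + z • (y - x)) - f x) (f (x + t • (y - x)) - f x)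
    rw [sub_sub_sub_cancel_right] at hdiff
    rw [slope_def_field, div_le_iff₀ htz]
    simp only [Function.comp_apply]
    linarith

theorem locallyLipschitzOn_of_finite_closed_cover {ι : Type*} {I : Set ι} (hI : I.Finite)
    {s : ι → Set E} (hs : ∀ i ∈ I, IsClosed (s i)) {U : Set E} (hU : IsOpen U)
    (hcover : U ⊆ ⋃ i ∈ I, s i) {f : E → F} {L : ℝ≥0}
    (hf : ∀ i ∈ I, LipschitzOnWith L f (s i ∩ U)) : LocallyLipschitzOn U f := by
  have hnear : ∀ x ∈ U, ∀ᶠ z in 𝓝 x, ‖f z - f x‖ ≤ L * ‖z - x‖ := by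
    intro x hx
    have hfar : ∀ᶠ z in 𝓝 x, ∀ i ∈ I, z ∈ s i → x ∈ s i := by
      refine (eventually_all_finite hI).2 fun i hi => ?_
      by_cases hxi : x ∈ s i
      · exact Eventually.of_forall fun _ _ => hxi
      · filter_upwards [(hs i hi).isOpen_compl.mem_nhds hxi] with z hz hzi
        exact absurd hzi hz
    filter_upwards [hfar, hU.mem_nhds hx] with z hz hzU
    obtain ⟨i, hi, hzi⟩ := mem_iUnion₂.1 (hcover hzU)
    simpa only [dist_eq_norm] using (hf i hi).dist_le_mul z ⟨hzi, hzU⟩ x ⟨hz i hi hzi, hx⟩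
  intro x hx
  obtain ⟨r, hr, hball⟩ := Metric.isOpen_iff.1 hU x hx
  exact ⟨L, ball x r, mem_nhdsWithin_of_mem_nhds (ball_mem_nhds x hr),
    lipschitzOnWith_of_eventually_norm_sub_le (convex_ball x r) fun y hy =>
      nhdsWithin_le_nhds (hnear y (hball hy))⟩

theorem exists_lipschitzWith_of_hasCompactSupport [ProperSpace E] {f : E → F}
    (hf : LocallyLipschitz f) (hc : HasCompactSupport f) : ∃ L, LipschitzWith L f := by
  obtain ⟨L, hL⟩ := (hf.locallyLipschitzOn (s := cthickening 1 (tsupport f))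
    ).exists_lipschitzOnWith_of_compact (IsCompact.cthickening hc)
  refine ⟨L, lipschitzOnWith_univ.1 <|
    lipschitzOnWith_of_eventually_norm_sub_le convex_univ fun x _ => ?_⟩
  rw [nhdsWithin_univ]
  by_cases hx : x ∈ tsupport f
  · have hnhds : cthickening 1 (tsupport f) ∈ 𝓝 x :=
      mem_of_superset (isOpen_thickening.mem_nhds (self_subset_thickening one_pos _ hx))
        (thickening_subset_cthickening 1 _)
    filter_upwards [hnhds] with z hz
    simpa only [dist_eq_norm] using hL.dist_le_mul z hz x (mem_of_mem_nhds hnhds)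
  · have h0 := notMem_tsupport_iff_eventuallyEq.1 hx
    filter_upwards [h0] with z hz
    rw [hz, h0.eq_of_nhds, Pi.zero_apply, Pi.zero_apply, sub_zero, norm_zero]
    positivity

theorem exists_lipschitzWith_mul [ProperSpace E] {U : Set E} (hU : IsOpen U) {f g : E → ℝ}
    (hf : LocallyLipschitzOn U f) (hg : ContDiff ℝ 1 g) (hc : HasCompactSupport g)
    (hs : tsupport g ⊆ U) : ∃ L, LipschitzWith L fun x => f x * g x :=
  exists_lipschitzWith_of_hasCompactSupport
    (locallyLipschitz_mul_of_tsupport_subset hU hf hg.locallyLipschitz hs) hc.mul_left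

variable [NormedSpace ℝ F] [FiniteDimensional ℝ E] [FiniteDimensional ℝ F] [MeasurableSpace E]
  [BorelSpace E] (μ : Measure E) [μ.IsAddHaarMeasure]

theorem ae_restrict_differentiableAt {U : Set E} (hU : IsOpen U) {f : E → F}
    (hf : LocallyLipschitzOn U f) : ∀ᵐ x ∂μ.restrict U, DifferentiableAt ℝ f x := by
  rw [ae_iff, Measure.restrict_apply₀' hU.measurableSet.nullMeasurableSet, inter_comm]
  refine measure_null_of_locally_null _ fun x hx => ?_
  obtain ⟨L, t, ht, hft⟩ := hf hx.1
  rw [hU.nhdsWithin_eq hx.1] at ht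
  refine ⟨_ ∩ interior t, inter_mem_nhdsWithin _ (interior_mem_nhds.2 ht),
    measure_mono_null ?_ (hft.mono interior_subset).ae_differentiableWithinAt_of_mem⟩
  intro y hy h
  exact hy.1.2 ((h hy.2).differentiableAt (isOpen_interior.mem_nhds hy.2))

end Lipschitz

/-! ### Mollification -/

section Mollify

open scoped ContDiff Convolution

variable {E : Type*} [NormedAddCommGroup E] [NormedSpace ℝ E] [FiniteDimensional ℝ E]
  [MeasurableSpace E] (μ : Measure E) {φ : ContDiffBump (0 : E)} {ψ g : E → ℝ} {L : ℝ≥0}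

/-- The smooth approximation of `g` obtained by convolution with the normalized bump function
`φ`. -/
def mollify (φ : ContDiffBump (0 : E)) (g : E → ℝ) : E → ℝ :=
  φ.normed μ ⋆[ContinuousLinearMap.lsmul ℝ ℝ, μ] g

theorem mollify_apply (x : E) : mollify μ φ g x = ∫ t, φ.normed μ t * g (x - t) ∂μ := rfl

variable [BorelSpace E] [μ.IsAddHaarMeasure]

theorem contDiff_mollify (hg : LocallyIntegrable g μ) : ContDiff ℝ ∞ (mollify μ φ g) :=
  φ.hasCompactSupport_normed.contDiff_convolution_left _ φ.contDiff_normed hg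

theorem tsupport_mollify_subset :
    tsupport (mollify μ φ g) ⊆ cthickening φ.rOut (tsupport g) := by
  refine closure_minimal ((support_convolution_subset _).trans ?_) isClosed_cthickening
  rw [φ.support_normed_eq]
  rintro _ ⟨a, ha, b, hb, rfl⟩
  refine mem_cthickening_of_dist_le _ b _ _ (subset_tsupport _ hb) ?_
  simpa [dist_eq_norm] using (mem_ball.1 ha).le

theorem abs_mollify_le {c : ℝ} (h : ∀ x, |g x| ≤ c) (x : E) : |mollify μ φ g x| ≤ c := by
  calc |mollify μ φ g x| ≤ ∫ t, φ.normed μ t * c ∂μ := by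
        rw [mollify_apply, ← Real.norm_eq_abs]
        refine norm_integral_le_of_norm_le (φ.integrable_normed.mul_const c)
          (Eventually.of_forall fun t => ?_)
        rw [Real.norm_eq_abs, abs_mul, abs_of_nonneg (φ.nonneg_normed t)]
        exact mul_le_mul_of_nonneg_left (h _) (φ.nonneg_normed t)
    _ = c := by rw [integral_mul_const, φ.integral_normed, one_mul]

theorem fderiv_mollify_apply (hψ : LipschitzWith L ψ) (x v : E) :
    fderiv ℝ (mollify μ φ ψ) x v = mollify μ φ (fun y => lineDeriv ℝ ψ y v) x := by
  have hφ : ContDiff ℝ 1 (φ.normed μ) := φ.contDiff_normed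
  have hφc : HasCompactSupport (φ.normed μ) := φ.hasCompactSupport_normed
  have hψi : LocallyIntegrable ψ μ := hψ.continuous.locallyIntegrable
  obtain ⟨K, hK⟩ := exists_lipschitzWith_of_hasCompactSupport hφ.locallyLipschitz hφc
  have hreflect : LipschitzWith (L * (0 + 1)) fun t => ψ (x - t) :=
    hψ.comp ((LipschitzWith.const x).sub LipschitzWith.id)
  calc fderiv ℝ (mollify μ φ ψ) x v
      = ∫ t, fderiv ℝ (φ.normed μ) t v * ψ (x - t) ∂μ := by
        rw [mollify, (hφc.hasFDerivAt_convolution_left _ hφ hψi x).fderiv]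
        exact ContinuousLinearMap.integral_apply (((hφc.fderiv ℝ).convolutionExists_left _
          (hφ.continuous_fderiv one_ne_zero) hψi x).integrable) v
    _ = ∫ t, lineDeriv ℝ (φ.normed μ) t (- -v) * ψ (x - t) ∂μ := by
        simp only [neg_neg, (hφ.differentiable one_ne_zero _).lineDeriv_eq_fderiv]
    _ = ∫ t, lineDeriv ℝ (fun t => ψ (x - t)) t (-v) * φ.normed μ t ∂μ :=
        (hreflect.integral_lineDeriv_mul_eq hK hφc (-v)).symm
    _ = mollify μ φ (fun y => lineDeriv ℝ ψ y v) x := by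
        simp only [mollify_apply, lineDeriv, smul_neg, ← sub_eq_add_neg, sub_sub_eq_add_sub,
          sub_add_eq_add_sub, mul_comm]

theorem exists_mollifying_sequence {δ : ℝ} (hδ : 0 < δ) :
    ∃ φ : ℕ → ContDiffBump (0 : E), (∀ n, (φ n).rOut ≤ δ) ∧
      ∀ g : E → ℝ, LocallyIntegrable g μ →
        ∀ᵐ x ∂μ, Tendsto (fun n => mollify μ (φ n) g x) atTop (𝓝 (g x)) := by
  -- The Lebesgue differentiation theorem requires a bounded ratio of the two radii.
  let φ : ℕ → ContDiffBump (0 : E) := fun n =>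
    ⟨δ / (n + 1) / 2, δ / (n + 1), by positivity, half_lt_self (by positivity)⟩
  have hrOut : ∀ n, (φ n).rOut = δ / (n + 1) := fun _ => rfl
  refine ⟨φ, fun n => ?_, fun g hg =>
    ContDiffBump.ae_convolution_tendsto_right_of_locallyIntegrable (K := 2) ?_
      (Eventually.of_forall fun n => ?_) hg⟩
  · exact div_le_self hδ.le (le_add_of_nonneg_left n.cast_nonneg)
  · simpa [hrOut, div_eq_mul_inv] using
      (tendsto_one_div_add_atTop_nhds_zero_nat (𝕜 := ℝ)).const_mul δ
  · exact (mul_div_cancel₀ _ two_ne_zero).ge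

theorem exists_testFunction_approx {Ω : Opens E} (hψ : LipschitzWith L ψ)
    (hc : HasCompactSupport ψ) (hs : tsupport ψ ⊆ Ω) :
    ∃ (Ψ : ℕ → 𝓓(Ω, ℝ)) (C : ℝ), (∀ n x, |Ψ n x| ≤ C) ∧
      (∀ n x v, |fderiv ℝ (Ψ n) x v| ≤ L * ‖v‖) ∧
      (∀ᵐ x ∂μ, Tendsto (fun n => Ψ n x) atTop (𝓝 (ψ x))) ∧
      ∀ v, ∀ᵐ x ∂μ, Tendsto (fun n => fderiv ℝ (Ψ n) x v) atTop (𝓝 (fderiv ℝ ψ x v)) := by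
  obtain ⟨δ, hδ, hδΩ⟩ := hc.isCompact.exists_cthickening_subset_open Ω.isOpen hs
  obtain ⟨φ, hφ, hlim⟩ := exists_mollifying_sequence (E := E) μ hδ
  have hψi : LocallyIntegrable ψ μ := hψ.continuous.locallyIntegrable
  have hsub : ∀ n, tsupport (mollify μ (φ n) ψ) ⊆ cthickening δ (tsupport ψ) := fun n =>
    (tsupport_mollify_subset μ).trans (cthickening_mono (hφ n) _)
  let Ψ : ℕ → 𝓓(Ω, ℝ) := fun n => ⟨mollify μ (φ n) ψ, contDiff_mollify μ hψi,
    hc.isCompact.cthickening.of_isClosed_subset (isClosed_tsupport _) (hsub n),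
    (hsub n).trans hδΩ⟩
  have hΨ : ∀ n x v, fderiv ℝ (Ψ n) x v = mollify μ (φ n) (fun y => lineDeriv ℝ ψ y v) x :=
    fun n => fderiv_mollify_apply μ hψ
  obtain ⟨C, hC⟩ := hψ.continuous.bounded_above_of_compact_support hc
  refine ⟨Ψ, C, fun n => abs_mollify_le μ hC, fun n x v => ?_, hlim ψ hψi, fun v => ?_⟩
  · rw [hΨ]
    exact abs_mollify_le μ (fun y => norm_lineDeriv_le_of_lipschitz ℝ hψ) x
  · filter_upwards [hlim _ (hψ.locallyIntegrable_lineDeriv v), hψ.ae_differentiableAt]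
      with x hx hdx
    simpa only [hΨ, hdx.lineDeriv_eq_fderiv] using hx

end Mollify

/-! ### Weak divergence -/

section WeakDiv

open scoped ContDiff

theorem measurable_partialDeriv (j : Fin 3) (ψ : R3 → ℝ) : Measurable (partialDeriv j ψ) :=
  measurable_fderiv_apply_const ℝ ψ _

theorem abs_partialDeriv_le (j : Fin 3) (ψ : R3 → ℝ) (x : R3) :
    |partialDeriv j ψ x| ≤ ‖fderiv ℝ ψ x‖ := by
  simpa [partialDeriv] using (fderiv ℝ ψ x).le_opNorm (EuclideanSpace.single j 1)

theorem tsupport_partialDeriv_subset (j : Fin 3) (ψ : R3 → ℝ) :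
    tsupport (partialDeriv j ψ) ⊆ tsupport ψ :=
  tsupport_fderiv_apply_subset ℝ _

theorem contDiff_partialDeriv {n : ℕ∞} {ψ : R3 → ℝ} (hψ : ContDiff ℝ (n + 1) ψ) (j : Fin 3) :
    ContDiff ℝ n (partialDeriv j ψ) :=
  (hψ.fderiv_right le_rfl).clm_apply contDiff_const

theorem integrable_mul_of_hasCompactSupport {X : Type*} [TopologicalSpace X] [MeasurableSpace X]
    [OpensMeasurableSpace X] {μ : Measure X} {f g : X → ℝ} (hf : Integrable f μ)
    (hg : Continuous g) (hc : HasCompactSupport g) : Integrable (fun x => f x * g x) μ := by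
  obtain ⟨C, hC⟩ := hg.bounded_above_of_compact_support hc
  exact hf.mul_bdd hg.aestronglyMeasurable (Eventually.of_forall hC)

variable {Ω Ω' : Opens R3} {v w : R3 → Fin 3 → ℝ} {d e ℓ ψ : R3 → ℝ} {L : ℝ≥0}

namespace IsWeakDiv

theorem mono (h : IsWeakDiv Ω v d) (hΩ : Ω' ≤ Ω) : IsWeakDiv Ω' v d := by
  intro φ
  have hzero : ∀ x ∉ (Ω' : Set R3), φ x = 0 ∧ ∀ j, partialDeriv j φ x = 0 := fun x hx =>
    have hx' : x ∉ tsupport φ := fun hx' => hx (φ.tsupport_subset hx')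
    ⟨image_eq_zero_of_notMem_tsupport hx', fun j =>
      image_eq_zero_of_notMem_tsupport fun h => hx' (tsupport_partialDeriv_subset j φ h)⟩
  have hrestrict : ∀ f : R3 → ℝ, (∀ x ∉ (Ω' : Set R3), f x = 0) →
      ∫ x in (Ω' : Set R3), f x = ∫ x in (Ω : Set R3), f x := fun f hf => by
    rw [setIntegral_eq_integral_of_forall_compl_eq_zero hf,
      setIntegral_eq_integral_of_forall_compl_eq_zero fun x hx => hf x fun hx' => hx (hΩ hx')]
  rw [hrestrict _ fun x hx => by simp [hzero x hx], hrestrict _ fun x hx => by simp [hzero x hx]]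
  exact h ⟨φ, φ.contDiff, φ.hasCompactSupport, φ.tsupport_subset.trans hΩ⟩

theorem congr (h : IsWeakDiv Ω v d) (hvw : ∀ᵐ x ∂volume.restrict (Ω : Set R3), v x = w x) :
    IsWeakDiv Ω w d := by
  intro φ
  rw [← h φ]
  exact integral_congr_ae (hvw.mono fun x hx => by simp only [hx])

theorem ae_eq (hd : IntegrableOn d Ω) (he : IntegrableOn e Ω)
    (hvd : IsWeakDiv Ω v d) (hve : IsWeakDiv Ω v e) : d =ᵐ[volume.restrict (Ω : Set R3)] e := by
  rw [EventuallyEq, ae_restrict_iff' Ω.isOpen.measurableSet]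
  have hzero := Ω.isOpen.ae_eq_zero_of_integral_contDiff_smul_eq_zero
    (hd.sub he).locallyIntegrableOn fun g hg hgc hgs => ?_
  · exact hzero.mono fun x hx hxΩ => sub_eq_zero.1 (hx hxΩ)
  have heq := neg_injective ((hvd ⟨g, hg, hgc, hgs⟩).symm.trans (hve ⟨g, hg, hgc, hgs⟩))
  rw [← setIntegral_eq_integral_of_forall_compl_eq_zero (s := (Ω : Set R3))]
  · simp only [Pi.sub_apply, smul_eq_mul, mul_comm (g _), sub_mul]
    rw [integral_sub (integrable_mul_of_hasCompactSupport hd hg.continuous hgc)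
      (integrable_mul_of_hasCompactSupport he hg.continuous hgc)]
    exact sub_eq_zero.2 heq
  · intro x hx
    rw [image_eq_zero_of_notMem_tsupport fun h => hx (hgs h), zero_smul]

theorem of_contDiff (hv : ∀ j, ContDiff ℝ 1 fun x => v x j) :
    IsWeakDiv Ω v fun x => ∑ j, partialDeriv j (fun y => v y j) x := by
  intro φ
  have hφ : ContDiff ℝ 1 φ := φ.contDiff.of_le (by simp)
  have hout : ∀ x ∉ (Ω : Set R3), x ∉ tsupport φ := fun x hx h => hx (φ.tsupport_subset h)
  have hcompact : ∀ {f g : R3 → ℝ}, Continuous f → Continuous g → tsupport g ⊆ tsupport φ →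
      Integrable fun x => f x * g x := by
    intro f g hf hg hs
    have hc : HasCompactSupport g := φ.hasCompactSupport.of_isClosed_subset (isClosed_tsupport _) hs
    exact (hf.mul hg).integrable_of_hasCompactSupport hc.mul_left
  have hpart : ∀ {f : R3 → ℝ}, ContDiff ℝ 1 f → ∀ j, Continuous (partialDeriv j f) :=
    fun hf j => (contDiff_partialDeriv (n := 0) (by simpa using hf) j).continuous
  have hint : ∀ j, Integrable fun x => v x j * partialDeriv j φ x := fun j =>
    hcompact (hv j).continuous (hpart hφ j) (tsupport_partialDeriv_subset j φ)
  have hint' : ∀ j, Integrable fun x => partialDeriv j (fun y => v y j) x * φ x := fun j =>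
    hcompact (hpart (hv j) j) hφ.continuous Subset.rfl
  rw [setIntegral_eq_integral_of_forall_compl_eq_zero,
    setIntegral_eq_integral_of_forall_compl_eq_zero]
  · simp only [Finset.sum_mul]
    rw [integral_finsetSum _ fun j _ => hint j, integral_finsetSum _ fun j _ => hint' j,
      ← Finset.sum_neg_distrib]
    refine Finset.sum_congr rfl fun j _ => ?_
    exact integral_mul_fderiv_eq_neg_fderiv_mul_of_integrable (hint' j) (hint j)
      (hcompact (hv j).continuous hφ.continuous Subset.rfl)
      (fun x _ => (hv j).differentiable one_ne_zero x)
      (fun x _ => hφ.differentiable one_ne_zero x)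
  · intro x hx
    rw [image_eq_zero_of_notMem_tsupport (hout x hx), mul_zero]
  · intro x hx
    refine Finset.sum_eq_zero fun j _ => ?_
    rw [image_eq_zero_of_notMem_tsupport fun h => hout x hx (tsupport_partialDeriv_subset j φ h),
      mul_zero]

theorem integral_lipschitz (h : IsWeakDiv Ω v d) (hv : ∀ j, IntegrableOn (fun x => v x j) Ω)
    (hd : IntegrableOn d Ω) (hψ : LipschitzWith L ψ) (hc : HasCompactSupport ψ)
    (hs : tsupport ψ ⊆ Ω) :
    ∫ x in (Ω : Set R3), ∑ j, v x j * partialDeriv j ψ x =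
      -∫ x in (Ω : Set R3), d x * ψ x := by
  obtain ⟨Ψ, C, hC, hL, hlim, hlim'⟩ := exists_testFunction_approx volume hψ hc hs
  have hleft : Tendsto (fun n => ∫ x in (Ω : Set R3), ∑ j, v x j * partialDeriv j (Ψ n) x) atTop
      (𝓝 (∫ x in (Ω : Set R3), ∑ j, v x j * partialDeriv j ψ x)) := by
    refine tendsto_integral_of_dominated_convergence (fun x => ∑ j, |v x j| * L)
      (fun n => ?_) ?_ (fun n => Eventually.of_forall fun x => ?_) ?_
    · exact Finset.aestronglyMeasurable_fun_sum _ fun j _ => (hv j).aestronglyMeasurable.mul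
        (measurable_partialDeriv j _).aestronglyMeasurable
    · exact integrable_finsetSum _ fun j _ => (hv j).abs.mul_const _
    · refine (norm_sum_le _ _).trans (Finset.sum_le_sum fun j _ => ?_)
      rw [norm_mul]
      exact mul_le_mul_of_nonneg_left
        (by simpa [partialDeriv] using hL n x (EuclideanSpace.single j 1)) (abs_nonneg _)
    · filter_upwards [ae_restrict_of_ae (ae_all_iff.2 fun j =>
        hlim' (EuclideanSpace.single j 1))] with x hx
      exact tendsto_finsetSum _ fun j _ => (hx j).const_mul _
  have hright : Tendsto (fun n => -∫ x in (Ω : Set R3), d x * Ψ n x) atTop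
      (𝓝 (-∫ x in (Ω : Set R3), d x * ψ x)) := by
    refine (tendsto_integral_of_dominated_convergence (fun x => |d x| * C)
      (fun n => ?_) (hd.abs.mul_const _) (fun n => Eventually.of_forall fun x => ?_) ?_).neg
    · exact hd.aestronglyMeasurable.mul (Ψ n).continuous.aestronglyMeasurable
    · rw [norm_mul]
      exact mul_le_mul_of_nonneg_left (hC n x) (abs_nonneg _)
    · filter_upwards [ae_restrict_of_ae hlim] with x hx
      exact hx.const_mul _
  refine tendsto_nhds_unique hleft ?_
  simpa only [h _] using hright

theorem mul (h : IsWeakDiv Ω v d) (hv : ∀ j, IntegrableOn (fun x => v x j) Ω)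
    (hd : IntegrableOn d Ω) (hℓ : LocallyLipschitzOn Ω ℓ) :
    IsWeakDiv Ω (fun x j => ℓ x * v x j) fun x =>
      ℓ x * d x + ∑ j, partialDeriv j ℓ x * v x j := by
  intro φ
  have hφ : ContDiff ℝ ∞ φ := φ.contDiff
  obtain ⟨L, hψ⟩ :=
    exists_lipschitzWith_mul Ω.isOpen hℓ (hφ.of_le (by simp)) φ.hasCompactSupport φ.tsupport_subset
  have hψc : HasCompactSupport fun x => ℓ x * φ x := φ.hasCompactSupport.mul_left
  have hψs : tsupport (fun x => ℓ x * φ x) ⊆ Ω :=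
    (tsupport_mul_subset_right (f := ℓ)).trans φ.tsupport_subset
  have hvψ : IntegrableOn (fun x => ∑ j, v x j * partialDeriv j (fun y => ℓ y * φ y) x) Ω :=
    integrable_finsetSum _ fun j _ =>
      (hv j).mul_bdd (measurable_partialDeriv _ _).aestronglyMeasurable
        (Eventually.of_forall fun x => (abs_partialDeriv_le j _ x).trans
          (norm_fderiv_le_of_lipschitz ℝ hψ))
  have hvφ : IntegrableOn (fun x => ∑ j, v x j * (ℓ x * partialDeriv j φ x)) Ω :=
    integrable_finsetSum _ fun j _ => by
      have hs := tsupport_partialDeriv_subset j φ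
      have hc : HasCompactSupport (partialDeriv j φ) :=
        φ.hasCompactSupport.of_isClosed_subset (isClosed_tsupport _) hs
      obtain ⟨K, hK⟩ := exists_lipschitzWith_mul Ω.isOpen hℓ
        ((contDiff_partialDeriv (n := ⊤) hφ j).of_le (by simp)) hc (hs.trans φ.tsupport_subset)
      exact integrable_mul_of_hasCompactSupport (hv j) hK.continuous hc.mul_left
  have hleibniz : ∀ᵐ x ∂volume.restrict (Ω : Set R3), (ℓ x * d x +
      ∑ j, partialDeriv j ℓ x * v x j) * φ x = d x * (ℓ x * φ x) +
        ((∑ j, v x j * partialDeriv j (fun y => ℓ y * φ y) x) -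
          ∑ j, v x j * (ℓ x * partialDeriv j φ x)) := by
    filter_upwards [ae_restrict_differentiableAt volume Ω.isOpen hℓ] with x hx
    simp only [partialDeriv, fderiv_fun_mul hx (hφ.differentiable (by simp) x), Fin.sum_univ_three,
      add_apply, smul_apply, smul_eq_mul]
    ring
  rw [integral_congr_ae hleibniz, integral_add
    (integrable_mul_of_hasCompactSupport hd hψ.continuous hψc) (hvψ.sub' hvφ),
    integral_sub hvψ hvφ, h.integral_lipschitz hv hd hψ hψc hψs]
  simp only [mul_left_comm, mul_assoc]
  ring

end IsWeakDiv

theorem weakDiv_spec (hv : v ∈ HDiv Ω) :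
    MemLp (weakDiv Ω v) 2 (volume.restrict (Ω : Set R3)) ∧ IsWeakDiv Ω v (weakDiv Ω v) := by
  rw [weakDiv, dif_pos hv.2]
  exact hv.2.choose_spec

end WeakDiv

/-! ### Polynomial functions -/

section Polynomial

theorem totalDegree_pderiv_le {σ R : Type*} [CommSemiring R] (j : σ) {p : MvPolynomial σ R}
    {k : ℕ} (hp : p.totalDegree ≤ k + 1) : (MvPolynomial.pderiv j p).totalDegree ≤ k := by
  refine Finset.sup_le fun m hm => ?_
  rw [MvPolynomial.mem_support_iff, MvPolynomial.coeff_pderiv] at hm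
  have hdeg := (MvPolynomial.le_totalDegree
    (MvPolynomial.mem_support_iff.2 (left_ne_zero_of_mul hm))).trans hp
  rw [Finsupp.sum_add_index' (fun _ => rfl) fun _ _ _ => rfl, Finsupp.sum_single_index rfl] at hdeg
  exact Nat.le_of_succ_le_succ hdeg

theorem totalDegree_bind₁_le {σ τ R : Type*} [CommSemiring R] {f : σ → MvPolynomial τ R} {d : ℕ}
    (hf : ∀ i, (f i).totalDegree ≤ d) (p : MvPolynomial σ R) :
    (MvPolynomial.bind₁ f p).totalDegree ≤ p.totalDegree * d := by
  conv_lhs => rw [p.as_sum, map_sum]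
  refine MvPolynomial.totalDegree_finsetSum_le fun s hs => ?_
  rw [MvPolynomial.bind₁_monomial]
  calc (MvPolynomial.C (p.coeff s) * ∏ i ∈ s.support, f i ^ s i).totalDegree
      ≤ ∑ i ∈ s.support, (f i ^ s i).totalDegree := by
        refine (MvPolynomial.totalDegree_mul _ _).trans ?_
        rw [MvPolynomial.totalDegree_C, zero_add]
        exact MvPolynomial.totalDegree_finsetProd _ _
    _ ≤ ∑ i ∈ s.support, s i * d := Finset.sum_le_sum fun i _ =>
        (MvPolynomial.totalDegree_pow _ _).trans (Nat.mul_le_mul_left _ (hf i))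
    _ = (s.sum fun _ e => e) * d := (Finset.sum_mul _ _ _).symm
    _ ≤ p.totalDegree * d := Nat.mul_le_mul_right _ (MvPolynomial.le_totalDegree hs)

/-- The polynomials of total degree at most `k` on `ℝⁿ`, as real functions: up to null sets, the
elements of `brokenPoly` restrict to such functions on each simplex. -/
def polyFun (n k : ℕ) : Submodule ℝ (EuclideanSpace ℝ (Fin n) → ℝ) :=
  (MvPolynomial.restrictTotalDegree (Fin n) ℝ k).map
    (MvPolynomial.aeval fun i x => x i : MvPolynomial (Fin n) ℝ →ₐ[ℝ] _).toLinearMap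

instance (n k : ℕ) : FiniteDimensional ℝ (polyFun n k) :=
  inferInstanceAs (Module.Finite ℝ (Submodule.map _ _))

variable {n m k l : ℕ} {f g : EuclideanSpace ℝ (Fin n) → ℝ}

theorem mem_polyFun : f ∈ polyFun n k ↔
    ∃ p : MvPolynomial (Fin n) ℝ, p.totalDegree ≤ k ∧ f = fun x => p.eval fun i => x i := by
  have heval : ∀ p : MvPolynomial (Fin n) ℝ,
      MvPolynomial.aeval (fun i (x : EuclideanSpace ℝ (Fin n)) => x i) p =
        fun x => p.eval fun i => x i := fun p => by
    ext x
    have hx := MvPolynomial.comp_aeval_apply (fun i (x : EuclideanSpace ℝ (Fin n)) => x i)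
      (Pi.evalAlgHom ℝ (fun _ => ℝ) x) p
    exact hx.trans (by simp [MvPolynomial.aeval_eq_eval])
  simp only [polyFun, Submodule.mem_map, MvPolynomial.mem_restrictTotalDegree,
    AlgHom.toLinearMap_apply, heval, eq_comm]

namespace polyFun

theorem const_mem (c : ℝ) : (fun _ => c) ∈ polyFun n k :=
  mem_polyFun.2 ⟨MvPolynomial.C c, by simp, by simp⟩

theorem mul_mem (hf : f ∈ polyFun n k) (hg : g ∈ polyFun n l) :
    (fun x => f x * g x) ∈ polyFun n (k + l) := by
  obtain ⟨p, hp, rfl⟩ := mem_polyFun.1 hf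
  obtain ⟨q, hq, rfl⟩ := mem_polyFun.1 hg
  exact mem_polyFun.2 ⟨p * q, (MvPolynomial.totalDegree_mul p q).trans (add_le_add hp hq),
    by simp only [map_mul]⟩

theorem affineMap_mem (A : EuclideanSpace ℝ (Fin n) →ᵃ[ℝ] ℝ) : (fun x => A x) ∈ polyFun n 1 := by
  refine mem_polyFun.2 ⟨MvPolynomial.C (A 0) +
    ∑ i, MvPolynomial.C (A.linear (EuclideanSpace.single i 1)) * MvPolynomial.X i, ?_, ?_⟩
  · refine (MvPolynomial.totalDegree_add _ _).trans (max_le (by simp) ?_)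
    refine MvPolynomial.totalDegree_finsetSum_le fun i _ => ?_
    exact (MvPolynomial.totalDegree_mul _ _).trans (by simp)
  · ext x
    have hx : x = ∑ i, x i • EuclideanSpace.single i (1 : ℝ) := by
      simpa using ((EuclideanSpace.basisFun (Fin n) ℝ).sum_repr x).symm
    conv_lhs => rw [A.decomp, hx]
    simp [mul_comm, add_comm]

theorem comp_affineMap (hf : f ∈ polyFun n k)
    (A : EuclideanSpace ℝ (Fin m) →ᵃ[ℝ] EuclideanSpace ℝ (Fin n)) :
    (fun x => f (A x)) ∈ polyFun m k := by
  obtain ⟨p, hp, rfl⟩ := mem_polyFun.1 hf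
  have hcoord : ∀ i, ∃ a : MvPolynomial (Fin m) ℝ, a.totalDegree ≤ 1 ∧
      (fun x => A x i) = fun x : EuclideanSpace ℝ (Fin m) => a.eval fun j => x j := fun i =>
    mem_polyFun.1 (affineMap_mem
      ((EuclideanSpace.proj i : EuclideanSpace ℝ (Fin n) →L[ℝ] ℝ).toLinearMap.toAffineMap.comp A))
  choose a ha hAa using hcoord
  refine mem_polyFun.2 ⟨p.bind₁ a, ?_, ?_⟩
  · exact (totalDegree_bind₁_le ha p).trans (by simpa using hp)
  · ext x
    rw [MvPolynomial.eval, MvPolynomial.eval₂Hom_bind₁]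
    exact congrArg (fun y => MvPolynomial.eval y p) (funext fun i => congrFun (hAa i) x)

end polyFun

theorem hasFDerivAt_eval (p : MvPolynomial (Fin n) ℝ) (x : EuclideanSpace ℝ (Fin n)) :
    HasFDerivAt (fun y : EuclideanSpace ℝ (Fin n) => p.eval fun i => y i)
      (∑ i, ((MvPolynomial.pderiv i p).eval fun i => x i) •
        (EuclideanSpace.proj i : EuclideanSpace ℝ (Fin n) →L[ℝ] ℝ)) x := by
  induction p using MvPolynomial.induction_on with
  | C a => simpa using hasFDerivAt_const a x
  | add p q hp hq =>
    simp only [map_add, add_smul, Finset.sum_add_distrib]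
    exact hp.fun_add hq
  | mul_X p i hp =>
    have hX : HasFDerivAt (fun y : EuclideanSpace ℝ (Fin n) => y i)
        (EuclideanSpace.proj i : EuclideanSpace ℝ (Fin n) →L[ℝ] ℝ) x :=
      (EuclideanSpace.proj i : EuclideanSpace ℝ (Fin n) →L[ℝ] ℝ).hasFDerivAt
    simp only [map_mul, MvPolynomial.eval_X]
    refine (hp.fun_mul hX).congr_fderiv ?_
    simp only [Derivation.leibniz, MvPolynomial.pderiv_X, smul_eq_mul, map_add, map_mul,
      MvPolynomial.eval_X, add_smul, mul_smul, Finset.sum_add_distrib, Finset.smul_sum]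
    congr 1
    rw [Finset.sum_eq_single i (fun j _ hj => by simp [Ne.symm hj]) (by simp)]
    simp

namespace polyFun

theorem contDiff (hf : f ∈ polyFun n k) {N : ℕ∞} : ContDiff ℝ N f := by
  obtain ⟨p, -, rfl⟩ := mem_polyFun.1 hf
  have hp : AnalyticOnNhd ℝ (fun x : EuclideanSpace ℝ (Fin n) =>
      MvPolynomial.aeval (fun i => x i) p) Set.univ :=
    AnalyticOnNhd.aeval_mvPolynomial (fun i =>
      (EuclideanSpace.proj i : EuclideanSpace ℝ (Fin n) →L[ℝ] ℝ).analyticOnNhd univ) p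
  simpa [MvPolynomial.aeval_eq_eval] using hp.contDiff

theorem fderiv_apply_mem (hf : f ∈ polyFun n (k + 1)) (v : EuclideanSpace ℝ (Fin n)) :
    (fun x => fderiv ℝ f x v) ∈ polyFun n k := by
  obtain ⟨p, hp, rfl⟩ := mem_polyFun.1 hf
  have hv : (fun x => fderiv ℝ (fun x => p.eval fun i => x i) x v) =
      ∑ i, v i • fun x : EuclideanSpace ℝ (Fin n) =>
        (MvPolynomial.pderiv i p).eval fun i => x i := by
    ext x
    simp [(hasFDerivAt_eval p x).fderiv, mul_comm]
  rw [hv]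
  exact Submodule.sum_mem _ fun i _ => Submodule.smul_mem _ _
    (mem_polyFun.2 ⟨_, totalDegree_pderiv_le i hp, rfl⟩)

theorem exists_eq_const (hf : f ∈ polyFun n 0) : ∃ c, f = fun _ => c := by
  obtain ⟨p, hp, rfl⟩ := mem_polyFun.1 hf
  rw [MvPolynomial.totalDegree_eq_zero_iff_eq_C.1 (Nat.le_zero.1 hp)]
  exact ⟨_, funext fun x => MvPolynomial.eval_C _⟩

theorem exists_eq_affineMap (hf : f ∈ polyFun n 1) :
    ∃ A : EuclideanSpace ℝ (Fin n) →ᵃ[ℝ] ℝ, f = A := by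
  have hconst : ∀ x, fderiv ℝ f x = fderiv ℝ f 0 := fun x => by
    ext v
    obtain ⟨c, hc⟩ := exists_eq_const (fderiv_apply_mem (k := 0) hf v)
    exact (congrFun hc x).trans (congrFun hc 0).symm
  have hdiff : Differentiable ℝ f := (contDiff hf (N := 1)).differentiable one_ne_zero
  refine ⟨(fderiv ℝ f 0).toLinearMap.toAffineMap + AffineMap.const ℝ _ (f 0), funext fun x => ?_⟩
  have hsub := is_const_of_fderiv_eq_zero (𝕜 := ℝ) (hdiff.sub (fderiv ℝ f 0).differentiable)
    (fun y => by
      rw [fderiv_sub (hdiff y) (fderiv ℝ f 0).differentiableAt, ContinuousLinearMap.fderiv,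
        hconst, sub_self]) x 0
  simp only [Pi.sub_apply, map_zero, sub_zero] at hsub
  simp [← hsub]

end polyFun

end Polynomial

/-! ### Weighted norms on finite-dimensional spaces -/

section WeightedNorm

theorem exists_norm_le_mul_norm_of_ker_le {V F G : Type*} [AddCommGroup V] [Module ℝ V]
    [FiniteDimensional ℝ V] [NormedAddCommGroup F] [NormedSpace ℝ F] [NormedAddCommGroup G]
    [NormedSpace ℝ G] {f : V →ₗ[ℝ] F} {g : V →ₗ[ℝ] G} (h : LinearMap.ker g ≤ LinearMap.ker f) :
    ∃ C : ℝ, 0 < C ∧ ∀ v, ‖f v‖ ≤ C * ‖g v‖ := by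
  let φ := LinearMap.toContinuousLinearMap
    ((LinearMap.ker g).liftQ f h ∘ₗ g.quotKerEquivRange.symm.toLinearMap)
  refine ⟨‖φ‖ + 1, by positivity, fun v => ?_⟩
  have hφ : φ ⟨g v, v, rfl⟩ = f v := by
    have hv := g.quotKerEquivRange_symm_apply_image v ⟨v, rfl⟩
    simp [φ, hv]
  calc ‖f v‖ ≤ ‖φ‖ * ‖g v‖ := hφ ▸ φ.le_opNorm ⟨g v, v, rfl⟩
    _ ≤ (‖φ‖ + 1) * ‖g v‖ := by gcongr; linarith

variable {α : Type*} [MeasurableSpace α] {μ : Measure α}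

/-- Multiplication by a weight `w` as a linear map to `L²`, so that `∫ (w f)²` is the squared norm
of the image of `f`. -/
def mulToLp (V : Submodule ℝ (α → ℝ)) (w : α → ℝ) (hV : ∀ f ∈ V, MemLp (fun x => w x * f x) 2 μ) :
    V →ₗ[ℝ] Lp ℝ 2 μ where
  toFun f := (hV f f.2).toLp
  map_add' f g := by
    rw [← MemLp.toLp_add]
    exact MemLp.toLp_congr _ _ (Eventually.of_forall fun x => mul_add _ _ _)
  map_smul' c f := by
    rw [RingHom.id_apply, ← MemLp.toLp_const_smul]
    exact MemLp.toLp_congr _ _ (Eventually.of_forall fun x => mul_left_comm _ _ _)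

theorem norm_sq_mulToLp {V : Submodule ℝ (α → ℝ)} {w : α → ℝ}
    (hV : ∀ f ∈ V, MemLp (fun x => w x * f x) 2 μ) (f : V) :
    ‖mulToLp V w hV f‖ ^ 2 = ∫ x, (w x * f.1 x) ^ 2 ∂μ := by
  rw [← real_inner_self_eq_norm_sq, L2.inner_def]
  refine integral_congr_ae ((hV f f.2).coeFn_toLp.mono fun x hx => ?_)
  simp only [mulToLp, LinearMap.coe_mk, AddHom.coe_mk, hx, real_inner_self_eq_norm_sq,
    Real.norm_eq_abs, sq_abs]

theorem mulToLp_eq_zero {V : Submodule ℝ (α → ℝ)} {w : α → ℝ}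
    (hV : ∀ f ∈ V, MemLp (fun x => w x * f x) 2 μ) (f : V) :
    mulToLp V w hV f = 0 ↔ ∀ᵐ x ∂μ, w x * f.1 x = 0 := by
  rw [Lp.eq_zero_iff_ae_eq_zero]
  exact (hV f f.2).coeFn_toLp.congr_left

theorem exists_integral_sq_le_integral_mul_sq (V : Submodule ℝ (α → ℝ)) [FiniteDimensional ℝ V]
    (hV : ∀ f ∈ V, MemLp f 2 μ) {w : α → ℝ} (hw : AEStronglyMeasurable w μ)
    (hw0 : ∀ᵐ x ∂μ, 0 < w x) (hw1 : ∀ᵐ x ∂μ, w x ≤ 1) :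
    ∃ C : ℝ, 0 < C ∧ ∀ f ∈ V, ∫ x, f x ^ 2 ∂μ ≤ C * ∫ x, w x * f x ^ 2 ∂μ := by
  have hV' : ∀ f ∈ V, MemLp (fun x => √(w x) * f x) 2 μ := fun f hf =>
    (hV f hf).mono ((Real.continuous_sqrt.comp_aestronglyMeasurable hw).mul (hV f hf).1)
      (hw1.mono fun x hx => by
      rw [norm_mul, Real.norm_of_nonneg (Real.sqrt_nonneg _)]
      exact mul_le_of_le_one_left (norm_nonneg _) (Real.sqrt_le_one.2 hx))
  have hV1 : ∀ f ∈ V, MemLp (fun x => 1 * f x) 2 μ := by simpa only [one_mul] using hV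
  have hker : LinearMap.ker (mulToLp V _ hV') ≤ LinearMap.ker (mulToLp V _ hV1) := fun f hf => by
    rw [LinearMap.mem_ker, mulToLp_eq_zero] at hf ⊢
    filter_upwards [hf, hw0] with x hx hwx
    rw [(mul_eq_zero.1 hx).resolve_left (Real.sqrt_ne_zero'.2 hwx), mul_zero]
  obtain ⟨C, hC, hle⟩ := exists_norm_le_mul_norm_of_ker_le hker
  refine ⟨C ^ 2, by positivity, fun f hf => ?_⟩
  have hsq := pow_le_pow_left₀ (norm_nonneg _) (hle ⟨f, hf⟩) 2
  rw [mul_pow, norm_sq_mulToLp, norm_sq_mulToLp] at hsq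
  have hweight : ∫ x, (√(w x) * f x) ^ 2 ∂μ = ∫ x, w x * f x ^ 2 ∂μ :=
    integral_congr_ae (hw0.mono fun x hx => by
      simp only [mul_pow, Real.sq_sqrt hx.le])
  simpa only [one_mul, hweight] using hsq

end WeightedNorm

/-! ### Simplices -/

section Simplex

theorem exists_affineEquiv_apply_eq {k V P ι : Type*} [Field k] [AddCommGroup V]
    [Module k V] [AddTorsor V P] (b b' : AffineBasis ι k P) :
    ∃ e : P ≃ᵃ[k] P, ∀ i, e (b i) = b' i := by
  obtain ⟨i₀⟩ := b.nonempty
  refine ⟨(AffineEquiv.vaddConst k (b i₀)).symm.trans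
    (((b.basisOf i₀).equiv (b'.basisOf i₀) (Equiv.refl _)).toAffineEquiv.trans
      (AffineEquiv.vaddConst k (b' i₀))), fun i => ?_⟩
  by_cases hi : i = i₀
  · simp [hi]
  · have hb := (b.basisOf i₀).equiv_apply ⟨i, hi⟩ (b'.basisOf i₀) (Equiv.refl _)
    simp only [AffineBasis.basisOf_apply, Equiv.refl_apply] at hb
    simp [hb]

theorem setIntegral_image_affineEquiv {E : Type*} [NormedAddCommGroup E] [NormedSpace ℝ E]
    [FiniteDimensional ℝ E] [MeasurableSpace E] [BorelSpace E] {μ : Measure E}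
    [μ.IsAddHaarMeasure] (e : E ≃ᵃ[ℝ] E) {s : Set E} (hs : MeasurableSet s) (f : E → ℝ) :
    ∫ x in e '' s, f x ∂μ = |LinearMap.det (e.linear : E →ₗ[ℝ] E)| * ∫ x in s, f (e x) ∂μ := by
  have hderiv : ∀ x ∈ s, HasFDerivWithinAt e
      (LinearMap.toContinuousLinearMap (e.linear : E →ₗ[ℝ] E)) s x := fun x _ =>
    (⟨e, AffineMap.continuous_of_finiteDimensional _⟩ : E →ᴬ[ℝ] E).hasFDerivWithinAt
  rw [integral_image_eq_integral_abs_det_fderiv_smul μ hs hderiv e.injective.injOn]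
  simp [integral_const_mul]

theorem coord_apply_of_apply_eq {k V P ι : Type*} [Field k] [AddCommGroup V]
    [Module k V] [AddTorsor V P] [Finite ι] {b b' : AffineBasis ι k P} {e : P ≃ᵃ[k] P}
    (h : ∀ i, e (b i) = b' i) (i : ι) (x : P) : b'.coord i (e x) = b.coord i x := by
  cases nonempty_fintype ι
  have hx : e x = Finset.univ.affineCombination k b' fun j => b.coord j x := by
    rw [show (b' : ι → P) = (e : P →ᵃ[k] P) ∘ b from funext fun i => (h i).symm,
      ← Finset.map_affineCombination _ _ _ (b.sum_coord_apply_eq_one x),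
      b.affineCombination_coord_eq_self]
    rfl
  rw [hx, b'.coord_apply_combination_of_mem (Finset.mem_univ i) (b.sum_coord_apply_eq_one x)]

theorem affineMap_apply_eq_sum_coord {k V P ι : Type*} [Field k] [AddCommGroup V]
    [Module k V] [AddTorsor V P] [Fintype ι] (b : AffineBasis ι k P) (a : P →ᵃ[k] k) (x : P) :
    a x = ∑ i, a (b i) * b.coord i x := by
  conv_lhs => rw [← b.affineCombination_coord_eq_self x]
  rw [Finset.map_affineCombination _ _ _ (b.sum_coord_apply_eq_one x),
    Finset.affineCombination_eq_linear_combination _ _ _ (b.sum_coord_apply_eq_one x)]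
  simp only [Function.comp_apply, smul_eq_mul, mul_comm]

theorem memLp_restrict_of_continuous {E : Type*} [MeasurableSpace E] [PseudoMetricSpace E]
    [ProperSpace E] [BorelSpace E] {μ : Measure E} [IsFiniteMeasureOnCompacts μ] {s : Set E}
    (hs : Bornology.IsBounded s) {f : E → ℝ} (hf : Continuous f) {p : ENNReal} :
    MemLp f p (μ.restrict s) := by
  have : IsFiniteMeasure (μ.restrict (closure s)) :=
    ⟨by simpa using hs.isCompact_closure.measure_lt_top⟩
  obtain ⟨B, hB⟩ := hs.isCompact_closure.exists_bound_of_continuousOn hf.continuousOn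
  exact (MemLp.of_bound hf.aestronglyMeasurable B
    (ae_restrict_of_forall_mem isClosed_closure.measurableSet hB)).mono_measure
    (Measure.restrict_mono subset_closure le_rfl)

theorem isBounded_interior_convexHull_range {E ι : Type*} [Finite ι] [NormedAddCommGroup E]
    [NormedSpace ℝ E] (v : ι → E) : Bornology.IsBounded (interior (convexHull ℝ (range v))) :=
  (isBounded_convexHull.2 (finite_range v).isBounded).subset interior_subset

theorem image_interior_convexHull {E ι : Type*} [Finite ι] [NormedAddCommGroup E]
    [NormedSpace ℝ E] {b b' : AffineBasis ι ℝ E} {e : E ≃ᵃ[ℝ] E} (h : ∀ i, e (b i) = b' i) :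
    e '' interior (convexHull ℝ (range b)) = interior (convexHull ℝ (range b')) := by
  ext x
  simp only [AffineBasis.interior_convexHull, mem_image, mem_ofPred_eq]
  constructor
  · rintro ⟨y, hy, rfl⟩
    simpa only [coord_apply_of_apply_eq h] using hy
  · refine fun hx => ⟨e.symm x, fun i => ?_, e.apply_symm_apply x⟩
    rw [← coord_apply_of_apply_eq h, e.apply_symm_apply]
    exact hx i

theorem setIntegral_coord_mul_sq_nonneg {ι E : Type*} [Finite ι] [NormedAddCommGroup E]
    [NormedSpace ℝ E] [MeasurableSpace E] [OpensMeasurableSpace E] {μ : Measure E}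
    (b : AffineBasis ι ℝ E) (i : ι) (q : E → ℝ) :
    0 ≤ ∫ x in interior (convexHull ℝ (range b)), b.coord i x * q x ^ 2 ∂μ :=
  setIntegral_nonneg isOpen_interior.measurableSet fun x hx => by
    rw [AffineBasis.interior_convexHull] at hx
    exact mul_nonneg (hx i).le (sq_nonneg _)

theorem exists_integral_sq_le_integral_coord_mul_sq {n : ℕ} (k : ℕ)
    (b : AffineBasis (Fin (n + 1)) ℝ (EuclideanSpace ℝ (Fin n))) :
    ∃ C : ℝ, 0 < C ∧ ∀ i, ∀ q ∈ polyFun n k,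
      ∫ x in interior (convexHull ℝ (range b)), q x ^ 2 ≤
        C * ∫ x in interior (convexHull ℝ (range b)), b.coord i x * q x ^ 2 := by
  have hweight : ∀ i, ∃ C : ℝ, 0 < C ∧ ∀ q ∈ polyFun n k,
      ∫ x in interior (convexHull ℝ (range b)), q x ^ 2 ≤
        C * ∫ x in interior (convexHull ℝ (range b)), b.coord i x * q x ^ 2 := fun i => by
    have hcoord : ∀ x ∈ interior (convexHull ℝ (range b)), ∀ j, 0 < b.coord j x := fun x hx => by
      rwa [AffineBasis.interior_convexHull] at hx
    refine exists_integral_sq_le_integral_mul_sq (polyFun n k)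
      (fun q hq => memLp_restrict_of_continuous (isBounded_interior_convexHull_range b)
        (polyFun.contDiff hq (N := 0)).continuous)
      (AffineMap.continuous_of_finiteDimensional _).aestronglyMeasurable
      (ae_restrict_of_forall_mem isOpen_interior.measurableSet fun x hx => hcoord x hx i)
      (ae_restrict_of_forall_mem isOpen_interior.measurableSet fun x hx => ?_)
    rw [← b.sum_coord_apply_eq_one x]
    exact Finset.single_le_sum (fun j _ => (hcoord x hx j).le) (Finset.mem_univ i)
  choose C hC hle using hweight
  refine ⟨∑ i, C i, Finset.sum_pos (fun i _ => hC i) Finset.univ_nonempty, fun i q hq => ?_⟩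
  exact (hle i q hq).trans (mul_le_mul_of_nonneg_right
    (Finset.single_le_sum (fun j _ => (hC j).le) (Finset.mem_univ i))
    (setIntegral_coord_mul_sq_nonneg b i q))

theorem exists_uniform_integral_sq_le_integral_coord_mul_sq (n k : ℕ) :
    ∃ C : ℝ, 0 < C ∧ ∀ (b : AffineBasis (Fin (n + 1)) ℝ (EuclideanSpace ℝ (Fin n))) (i),
      ∀ q ∈ polyFun n k, ∫ x in interior (convexHull ℝ (range b)), q x ^ 2 ≤
        C * ∫ x in interior (convexHull ℝ (range b)), b.coord i x * q x ^ 2 := by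
  obtain ⟨b₀⟩ := AffineBasis.exists_affineBasis_of_finiteDimensional (ι := Fin (n + 1)) (k := ℝ)
    (P := EuclideanSpace ℝ (Fin n)) (by simp)
  obtain ⟨C, hC, hle⟩ := exists_integral_sq_le_integral_coord_mul_sq k b₀
  refine ⟨C, hC, fun b i q hq => ?_⟩
  obtain ⟨e, he⟩ := exists_affineEquiv_apply_eq b₀ b
  rw [← image_interior_convexHull he,
    setIntegral_image_affineEquiv e isOpen_interior.measurableSet,
    setIntegral_image_affineEquiv e isOpen_interior.measurableSet, mul_left_comm]
  simp only [coord_apply_of_apply_eq he]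
  exact mul_le_mul_of_nonneg_left (hle i _ (polyFun.comp_affineMap hq e.toAffineMap))
    (abs_nonneg _)

theorem exists_affineMap_mul_integral_sq_le (n k : ℕ) :
    ∃ C : ℝ, 0 < C ∧ ∀ (b : AffineBasis (Fin (n + 1)) ℝ (EuclideanSpace ℝ (Fin n)))
      (a : EuclideanSpace ℝ (Fin n) →ᵃ[ℝ] ℝ), (∀ i, 0 ≤ a (b i)) → ∀ i, ∀ q ∈ polyFun n k,
        a (b i) * ∫ x in interior (convexHull ℝ (range b)), q x ^ 2 ≤
          C * ∫ x in interior (convexHull ℝ (range b)), a x * q x ^ 2 := by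
  obtain ⟨C, hC, hle⟩ := exists_uniform_integral_sq_le_integral_coord_mul_sq n k
  refine ⟨C, hC, fun b a ha i q hq => ?_⟩
  have hint : ∀ j, IntegrableOn (fun x => a (b j) * (b.coord j x * q x ^ 2))
      (interior (convexHull ℝ (range b))) := fun j =>
    memLp_one_iff_integrable.1 (memLp_restrict_of_continuous
      (isBounded_interior_convexHull_range b) (continuous_const.mul
        ((AffineMap.continuous_of_finiteDimensional _).mul
          ((polyFun.contDiff hq (N := 0)).continuous.pow 2))))
  calc a (b i) * ∫ x in interior (convexHull ℝ (range b)), q x ^ 2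
      ≤ a (b i) * (C * ∫ x in interior (convexHull ℝ (range b)), b.coord i x * q x ^ 2) :=
        mul_le_mul_of_nonneg_left (hle b i q hq) (ha i)
    _ = C * (a (b i) * ∫ x in interior (convexHull ℝ (range b)), b.coord i x * q x ^ 2) :=
        mul_left_comm _ _ _
    _ ≤ C * ∑ j, a (b j) * ∫ x in interior (convexHull ℝ (range b)), b.coord j x * q x ^ 2 := by
        gcongr
        exact Finset.single_le_sum (f := fun j =>
          a (b j) * ∫ x in interior (convexHull ℝ (range b)), b.coord j x * q x ^ 2)
          (fun j _ => mul_nonneg (ha j) (setIntegral_coord_mul_sq_nonneg b j q))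
          (Finset.mem_univ i)
    _ = C * ∫ x in interior (convexHull ℝ (range b)), a x * q x ^ 2 := by
        simp only [← integral_const_mul C, ← integral_const_mul (a _)]
        rw [← integral_finsetSum _ fun j _ => hint j, ← integral_const_mul]
        congr 1 with x
        rw [affineMap_apply_eq_sum_coord b a x, Finset.sum_mul]
        simp only [mul_assoc]

end Simplex

/-! ### Simplicial meshes and piecewise polynomials -/

section Mesh

variable {k l : ℕ} {𝒯 : Set (Set R3)} {f g : R3 → ℝ}

theorem convexHull_range_subset_closure_interior {ι E : Type*} [Finite ι]
    [NormedAddCommGroup E] [NormedSpace ℝ E] (b : AffineBasis ι ℝ E) :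
    convexHull ℝ (range b) ⊆ closure (interior (convexHull ℝ (range b))) := by
  have := b.finiteDimensional
  rw [(convex_convexHull ℝ _).closure_interior_eq_closure_of_nonempty_interior
    (interior_convexHull_nonempty_iff_affineSpan_eq_top.2 b.tot)]
  exact subset_closure

theorem mem_brokenPoly :
    f ∈ brokenPoly k 𝒯 ↔ ∀ T ∈ 𝒯, ∃ q ∈ polyFun 3 k, f =ᵐ[volume.restrict T] q := by
  refine forall₂_congr fun T _ => ⟨?_, ?_⟩
  · rintro ⟨p, hp, hfp⟩
    exact ⟨_, mem_polyFun.2 ⟨p, hp, rfl⟩, hfp⟩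
  · rintro ⟨q, hq, hfq⟩
    obtain ⟨p, hp, rfl⟩ := mem_polyFun.1 hq
    exact ⟨p, hp, hfq⟩

theorem mul_mem_brokenPoly (hf : f ∈ brokenPoly k 𝒯) (hg : g ∈ brokenPoly l 𝒯) :
    (fun x => f x * g x) ∈ brokenPoly (k + l) 𝒯 := by
  refine mem_brokenPoly.2 fun T hT => ?_
  obtain ⟨p, hp, hfp⟩ := mem_brokenPoly.1 hf T hT
  obtain ⟨q, hq, hgq⟩ := mem_brokenPoly.1 hg T hT
  exact ⟨_, polyFun.mul_mem hp hq, hfp.mul hgq⟩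

theorem brokenPoly_anti {𝒮 : Set (Set R3)} (h : ∀ S ∈ 𝒮, ∃ T ∈ 𝒯, S ⊆ T) :
    brokenPoly k 𝒯 ⊆ brokenPoly k 𝒮 := by
  intro f hf S hS
  obtain ⟨T, hT, hST⟩ := h S hS
  obtain ⟨p, hp, hfp⟩ := hf T hT
  exact ⟨p, hp, ae_restrict_of_ae_restrict_of_subset hST hfp⟩

theorem exists_forall_eqOn_of_pairwiseDisjoint {α β : Type*} {𝒮 : Set (Set α)}
    (h𝒮 : 𝒮.PairwiseDisjoint id) (F : Set α → α → β) : ∃ f : α → β, ∀ S ∈ 𝒮, EqOn f (F S) S := by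
  classical
  have hunique : ∀ x, ∃ T : Set α, ∀ S ∈ 𝒮, x ∈ S → T = S := fun x => by
    by_cases hx : ∃ T ∈ 𝒮, x ∈ T
    · obtain ⟨T, hT, hxT⟩ := hx
      exact ⟨T, fun S hS hxS => h𝒮.elim_set hT hS x hxT hxS⟩
    · exact ⟨∅, fun S hS hxS => (hx ⟨S, hS, hxS⟩).elim⟩
  choose T hT using hunique
  exact ⟨fun x => F (T x) x, fun S hS x hxS => congrArg (F · x) (hT x S hS hxS)⟩

namespace SimplicialMesh

variable {Ω : Set R3} (M : SimplicialMesh Ω) {T : Set R3}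

theorem finite_cells : M.cells.Finite := by
  refine (M.finite_faces.image fun t : Finset R3 => interior (convexHull ℝ (t : Set R3))).subset ?_
  rintro T ⟨t, ht, -, rfl⟩
  exact mem_image_of_mem _ ht

variable {M}

theorem isOpen_of_mem_cells (hT : T ∈ M.cells) : IsOpen T := by
  obtain ⟨t, -, -, rfl⟩ := hT
  exact isOpen_interior

theorem subset_of_mem_cells (hT : T ∈ M.cells) : T ⊆ Ω := by
  obtain ⟨t, ht, hcard, rfl⟩ := hT
  exact M.interior_subset t ht hcard

theorem exists_affineBasis_range_eq {t : Finset R3} (ht : t ∈ M.faces) (hcard : t.card = 4) :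
    ∃ b : AffineBasis (Fin 4) ℝ R3, range b = t := by
  let e : Fin 4 ≃ t := (Finset.equivFinOfCardEq hcard).symm
  have hind : AffineIndependent ℝ fun i => (e i : R3) :=
    (M.indep ht).comp_embedding e.toEmbedding
  refine ⟨⟨_, hind, hind.affineSpan_eq_top_iff_card_eq_finrank_add_one.2 (by simp)⟩, ?_⟩
  change range (Subtype.val ∘ e) = _
  rw [e.surjective.range_comp, Subtype.range_coe]

theorem exists_affineBasis (hT : T ∈ M.cells) :
    ∃ b : AffineBasis (Fin 4) ℝ R3, T = interior (convexHull ℝ (range b)) := by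
  obtain ⟨t, ht, hcard, rfl⟩ := hT
  obtain ⟨b, hb⟩ := exists_affineBasis_range_eq ht hcard
  exact ⟨b, by rw [hb]⟩

theorem convex_of_mem_cells (hT : T ∈ M.cells) : Convex ℝ T := by
  obtain ⟨t, -, -, rfl⟩ := hT
  exact (convex_convexHull ℝ _).interior

theorem isBounded_of_mem_cells (hT : T ∈ M.cells) : Bornology.IsBounded T := by
  obtain ⟨b, rfl⟩ := exists_affineBasis hT
  exact isBounded_interior_convexHull_range b

variable (M)

theorem pairwiseDisjoint_cells : M.cells.PairwiseDisjoint id := by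
  classical
  rintro _ ⟨s, hs, hscard, rfl⟩ _ ⟨t, ht, htcard, rfl⟩ hst
  -- If two open cells meet, their common face has an interior, hence four vertices.
  refine Set.disjoint_iff_inter_eq_empty.2 (by_contra fun hne => hst ?_)
  have hsub : interior (convexHull ℝ (s : Set R3)) ∩ interior (convexHull ℝ (t : Set R3)) ⊆
      interior (convexHull ℝ ((s ∩ t : Finset R3) : Set R3)) := by
    refine interior_maximal ?_ (isOpen_interior.inter isOpen_interior)
    rw [Finset.coe_inter]
    exact (inter_subset_inter _root_.interior_subset _root_.interior_subset).trans
      (M.inter_subset_convexHull hs ht)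
  have hspan := interior_convexHull_nonempty_iff_affineSpan_eq_top.1
    ((nonempty_iff_ne_empty.2 hne).mono hsub)
  have hind : AffineIndependent ℝ ((↑) : (s ∩ t : Finset R3) → R3) :=
    (M.indep hs).mono (Finset.coe_subset.2 Finset.inter_subset_left)
  have hcard := hind.affineSpan_eq_top_iff_card_eq_finrank_add_one.1
    (by rw [Subtype.range_coe]; exact hspan)
  simp only [Fintype.card_coe, finrank_euclideanSpace, Fintype.card_fin] at hcard
  rw [← Finset.eq_of_subset_of_card_le (Finset.inter_subset_left (s₁ := s) (s₂ := t)) (by omega),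
    Finset.eq_of_subset_of_card_le (Finset.inter_subset_right (s₁ := s) (s₂ := t)) (by omega)]

theorem subset_biUnion_closure : Ω ⊆ ⋃ T ∈ M.cells, closure T := by
  intro x hx
  have hx' := subset_closure hx
  simp only [← M.space_eq, mem_iUnion] at hx'
  obtain ⟨s, hs, hxs⟩ := hx'
  obtain ⟨t, ht, hst, hcard⟩ := M.pure s hs
  refine mem_biUnion (x := interior (convexHull ℝ (t : Set R3))) ⟨t, ht, hcard, rfl⟩ ?_
  obtain ⟨b, hb⟩ := exists_affineBasis_range_eq ht hcard
  rw [← hb]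
  exact convexHull_range_subset_closure_interior b
    (convexHull_mono (by rw [hb]; exact Finset.coe_subset.2 hst) hxs)

theorem isFiniteMeasure_restrict (M : SimplicialMesh Ω) : IsFiniteMeasure (volume.restrict Ω) :=
  have hbounded : Bornology.IsBounded (⋃ T ∈ M.cells, closure T) :=
    (Bornology.isBounded_biUnion M.finite_cells).2 fun _ hT => (isBounded_of_mem_cells hT).closure
  MeasureTheory.isFiniteMeasure_restrict.2
    (hbounded.subset M.subset_biUnion_closure).measure_lt_top.ne

theorem ae_eq_biUnion_cells : Ω =ᵐ[volume] ⋃ T ∈ M.cells, T := by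
  refine ae_eq_set.2 ⟨?_, ?_⟩
  · have hfrontier : volume (⋃ T ∈ M.cells, frontier T) = 0 :=
      (measure_biUnion_null_iff M.finite_cells.countable).2 fun T hT =>
        (convex_of_mem_cells hT).addHaar_frontier volume
    refine measure_mono_null ?_ hfrontier
    rintro x ⟨hx, hxn⟩
    obtain ⟨T, hT, hxT⟩ := mem_iUnion₂.1 (M.subset_biUnion_closure hx)
    exact mem_biUnion hT ⟨hxT, fun hxi => hxn (mem_biUnion hT (_root_.interior_subset hxi))⟩
  · have hsub : ⋃ T ∈ M.cells, T ⊆ Ω := iUnion₂_subset fun T hT => subset_of_mem_cells hT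
    rw [sdiff_eq_empty.2 hsub, measure_empty]

theorem ae_restrict_iff_forall_cells (p : R3 → Prop) :
    (∀ᵐ x ∂volume.restrict Ω, p x) ↔ ∀ T ∈ M.cells, ∀ᵐ x ∂volume.restrict T, p x := by
  rw [Measure.restrict_congr_set M.ae_eq_biUnion_cells,
    ae_restrict_biUnion_iff _ M.finite_cells.countable]

theorem integrableOn_iff_forall_cells :
    IntegrableOn f Ω ↔ ∀ T ∈ M.cells, IntegrableOn f T := by
  rw [integrableOn_congr_set_ae M.ae_eq_biUnion_cells, integrableOn_finite_biUnion M.finite_cells]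

theorem setIntegral_le_of_forall_cells (hf : IntegrableOn f Ω) (hg : IntegrableOn g Ω)
    (hfg : ∀ T ∈ M.cells, ∫ x in T, f x ≤ ∫ x in T, g x) : ∫ x in Ω, f x ≤ ∫ x in Ω, g x := by
  have hsum : ∀ h : R3 → ℝ, IntegrableOn h Ω →
      ∫ x in Ω, h x = ∑ T ∈ M.finite_cells.toFinset, ∫ x in T, h x := fun h hh => by
    rw [Measure.restrict_congr_set M.ae_eq_biUnion_cells]
    simpa using integral_biUnion_finset (s := id) M.finite_cells.toFinset
      (fun T hT => (isOpen_of_mem_cells (M.finite_cells.mem_toFinset.1 hT)).measurableSet)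
      (by rw [Finite.coe_toFinset]; exact M.pairwiseDisjoint_cells)
      fun T hT => hh.mono_set (subset_of_mem_cells (M.finite_cells.mem_toFinset.1 hT))
  rw [hsum f hf, hsum g hg]
  exact Finset.sum_le_sum fun T hT => hfg T (M.finite_cells.mem_toFinset.1 hT)

end SimplicialMesh

end Mesh

section Majorant

theorem nonneg_apply_of_ae_nonneg {ι E : Type*} [Finite ι] [NormedAddCommGroup E] [NormedSpace ℝ E]
    [MeasurableSpace E] {μ : Measure E} [μ.IsOpenPosMeasure] {b : AffineBasis ι ℝ E} {f : E → ℝ}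
    (hf : Continuous f) (hpos : ∀ᵐ x ∂μ.restrict (interior (convexHull ℝ (range b))), 0 ≤ f x)
    (i : ι) : 0 ≤ f (b i) := by
  have hmax := Measure.eqOn_open_of_ae_eq (f := fun x => max 0 (f x)) (g := f)
    (hpos.mono fun x hx => max_eq_right hx) isOpen_interior
    (continuous_const.max hf).continuousOn hf.continuousOn
  exact max_eq_right_iff.1 (hmax.closure (continuous_const.max hf) hf
    (convexHull_range_subset_closure_interior b (subset_convexHull ℝ _ (mem_range_self i))))

theorem exists_const_majorant (n k : ℕ) : ∃ C, 0 < C ∧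
    ∀ (b : AffineBasis (Fin (n + 1)) ℝ (EuclideanSpace ℝ (Fin n)))
      (a : EuclideanSpace ℝ (Fin n) →ᵃ[ℝ] ℝ), (∀ i, 0 ≤ a (b i)) →
      ∃ m, (∀ x ∈ convexHull ℝ (range b), a x ≤ m) ∧ ∀ q ∈ polyFun n k,
        ∫ x in interior (convexHull ℝ (range b)), (m * q x) ^ 2 ≤
          C * ∫ x in interior (convexHull ℝ (range b)), a x * q x * (m * q x) := by
  obtain ⟨C, hC, hbound⟩ := exists_affineMap_mul_integral_sq_le n k
  refine ⟨C, hC, fun b a ha => ?_⟩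
  obtain ⟨i, -, hi⟩ := Finset.exists_max_image Finset.univ (fun i => a (b i)) Finset.univ_nonempty
  refine ⟨a (b i), fun x hx => ?_, fun q hq => ?_⟩
  · have hsub : range b ⊆ a ⁻¹' Iic (a (b i)) :=
      range_subset_iff.2 fun j => hi j (Finset.mem_univ j)
    exact convexHull_min hsub ((convex_Iic _).affine_preimage a) hx
  · have hmul := mul_le_mul_of_nonneg_left (hbound b a ha i q hq) (ha i)
    have hpull : ∫ x in interior (convexHull ℝ (range b)), a x * q x * (a (b i) * q x) =
        a (b i) * ∫ x in interior (convexHull ℝ (range b)), a x * q x ^ 2 := by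
      rw [← integral_const_mul]
      exact integral_congr_ae (.of_forall fun x => by ring)
    simp only [mul_pow, integral_const_mul, hpull]
    linarith

end Majorant

section BrokenPoly

variable {Ω : Set R3} {M : SimplicialMesh Ω} {k : ℕ} {f : R3 → ℝ}

theorem integrableOn_of_mem_brokenPoly (hf : f ∈ brokenPoly k M.cells) : IntegrableOn f Ω := by
  refine M.integrableOn_iff_forall_cells.2 fun T hT => ?_
  obtain ⟨q, hq, hfq⟩ := mem_brokenPoly.1 hf T hT
  exact (memLp_one_iff_integrable.1 (memLp_restrict_of_continuous
    (SimplicialMesh.isBounded_of_mem_cells hT)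
    (polyFun.contDiff hq (N := 0)).continuous)).congr hfq.symm

theorem memLp_two_of_mem_brokenPoly (hf : f ∈ brokenPoly k M.cells) :
    MemLp f 2 (volume.restrict Ω) := by
  refine (memLp_two_iff_integrable_sq (integrableOn_of_mem_brokenPoly hf).1).2 ?_
  simp only [sq]
  exact integrableOn_of_mem_brokenPoly (mul_mem_brokenPoly hf hf)

theorem exists_affineMap_of_mem_brokenPoly_one {T : Set R3} (hf : f ∈ brokenPoly 1 M.cells)
    (hT : T ∈ M.cells) : ∃ a : R3 →ᵃ[ℝ] ℝ, f =ᵐ[volume.restrict T] a := by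
  obtain ⟨q, hq, hfq⟩ := mem_brokenPoly.1 hf T hT
  obtain ⟨a, rfl⟩ := polyFun.exists_eq_affineMap hq
  exact ⟨a, hfq⟩

theorem exists_cell_majorant (k : ℕ) : ∃ C, 0 < C ∧
    ∀ {Ω : Set R3} {M : SimplicialMesh Ω} {ℓ : R3 → ℝ}, ℓ ∈ brokenPoly 1 M.cells →
      (∀ᵐ x ∂volume.restrict Ω, 0 ≤ ℓ x) → ∀ T ∈ M.cells,
      ∃ m, (∀ᵐ x ∂volume.restrict T, ℓ x ≤ m) ∧ ∀ f ∈ brokenPoly k M.cells,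
        ∫ x in T, (m * f x) ^ 2 ≤ C * ∫ x in T, ℓ x * f x * (m * f x) := by
  obtain ⟨C, hC, hbound⟩ := exists_const_majorant 3 k
  refine ⟨C, hC, fun {Ω M ℓ} hℓ hpos T hT => ?_⟩
  obtain ⟨a, ha⟩ := exists_affineMap_of_mem_brokenPoly_one hℓ hT
  have hposT : ∀ᵐ x ∂volume.restrict T, 0 ≤ a x := by
    filter_upwards [(M.ae_restrict_iff_forall_cells _).1 hpos T hT, ha] with x hx hax
    rwa [← hax]
  obtain ⟨b, rfl⟩ := SimplicialMesh.exists_affineBasis hT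
  obtain ⟨m, hm, hmbound⟩ := hbound b a
    (nonneg_apply_of_ae_nonneg a.continuous_of_finiteDimensional hposT)
  refine ⟨m, ?_, fun f hf => ?_⟩
  · filter_upwards [ha, ae_restrict_mem measurableSet_interior] with x hax hx
    rw [hax]
    exact hm x (interior_subset hx)
  · obtain ⟨q, hq, hfq⟩ := mem_brokenPoly.1 hf _ hT
    convert hmbound q hq using 1
    · exact integral_congr_ae (hfq.mono fun x hx => by simp only [hx])
    · refine congrArg _ (integral_congr_ae ?_)
      filter_upwards [ha, hfq] with x hax hx
      rw [hax, hx]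

theorem exists_brokenPoly_majorant (k : ℕ) : ∃ C, 0 < C ∧
    ∀ {Ω : Set R3} {M : SimplicialMesh Ω} {ℓ : R3 → ℝ}, ℓ ∈ brokenPoly 1 M.cells →
      (∀ᵐ x ∂volume.restrict Ω, 0 ≤ ℓ x) →
      ∃ μ ∈ brokenPoly 0 M.cells, (∀ᵐ x ∂volume.restrict Ω, ℓ x ≤ μ x) ∧
        ∀ f ∈ brokenPoly k M.cells,
          ∫ x in Ω, (μ x * f x) ^ 2 ≤ C * ∫ x in Ω, ℓ x * f x * (μ x * f x) := by
  obtain ⟨C, hC, hcell⟩ := exists_cell_majorant k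
  refine ⟨C, hC, fun {Ω M ℓ} hℓ hpos => ?_⟩
  choose! m hm hbound using hcell hℓ hpos
  obtain ⟨μ, hμ⟩ := exists_forall_eqOn_of_pairwiseDisjoint M.pairwiseDisjoint_cells fun T _ => m T
  have hμT : ∀ T ∈ M.cells, μ =ᵐ[volume.restrict T] fun _ => m T := fun T hT =>
    (ae_restrict_mem (SimplicialMesh.isOpen_of_mem_cells hT).measurableSet).mono (hμ T hT)
  have hμmem : μ ∈ brokenPoly 0 M.cells :=
    mem_brokenPoly.2 fun T hT => ⟨_, polyFun.const_mem (m T), hμT T hT⟩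
  refine ⟨μ, hμmem, (M.ae_restrict_iff_forall_cells _).2 fun T hT => ?_, fun f hf => ?_⟩
  · filter_upwards [hm T hT, hμT T hT] with x hx hμx
    rwa [hμx]
  · have hμf := mul_mem_brokenPoly hμmem hf
    rw [← integral_const_mul]
    refine M.setIntegral_le_of_forall_cells
      (by simpa only [sq] using integrableOn_of_mem_brokenPoly (mul_mem_brokenPoly hμf hμf))
      ((integrableOn_of_mem_brokenPoly
        (mul_mem_brokenPoly (mul_mem_brokenPoly hℓ hf) hμf)).const_mul C) fun T hT => ?_
    convert hbound T hT f hf using 1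
    · exact integral_congr_ae ((hμT T hT).mono fun x hx => by simp only [hx])
    · rw [integral_const_mul]
      exact congrArg _ (integral_congr_ae ((hμT T hT).mono fun x hx => by simp only [hx]))

theorem exists_lipschitzOnWith_of_mem_contPoly (hf : f ∈ contPoly Ω k M.cells) {T : Set R3}
    (hT : T ∈ M.cells) : ∃ L : ℝ≥0, LipschitzOnWith L f (closure T ∩ Ω) := by
  obtain ⟨q, hq, hfq⟩ := mem_brokenPoly.1 hf.1 T hT
  have hqc : ContDiff ℝ 1 q := polyFun.contDiff hq
  have hsub := SimplicialMesh.subset_of_mem_cells hT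
  have hEq : EqOn f q (closure T ∩ Ω) :=
    (Measure.eqOn_open_of_ae_eq hfq (SimplicialMesh.isOpen_of_mem_cells hT)
      (hf.2.mono hsub) hqc.continuous.continuousOn).of_subset_closure
      (hf.2.mono inter_subset_right) hqc.continuous.continuousOn
      (subset_inter subset_closure hsub) inter_subset_left
  obtain ⟨L, hL⟩ := hqc.contDiffOn.exists_lipschitzOnWith one_ne_zero
    (SimplicialMesh.convex_of_mem_cells hT).closure
    (SimplicialMesh.isBounded_of_mem_cells hT).isCompact_closure
  exact ⟨L, fun x hx y hy => by rw [hEq hx, hEq hy]; exact hL hx.1 hy.1⟩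

theorem locallyLipschitzOn_of_mem_contPoly (hΩ : IsOpen Ω) (hf : f ∈ contPoly Ω k M.cells) :
    LocallyLipschitzOn Ω f := by
  choose! L hL using fun T (hT : T ∈ M.cells) => exists_lipschitzOnWith_of_mem_contPoly hf hT
  refine locallyLipschitzOn_of_finite_closed_cover (s := closure)
    (L := ∑ T ∈ M.finite_cells.toFinset, L T) M.finite_cells
    (fun T _ => isClosed_closure) hΩ M.subset_biUnion_closure fun T hT => (hL T hT).weaken ?_
  exact Finset.single_le_sum (fun _ _ => zero_le) (M.finite_cells.mem_toFinset.2 hT)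

end BrokenPoly

/-! ### Discrete spaces and the length scale -/

section DiscreteSpaces

variable {Ω : Opens R3} {M : SimplicialMesh (Ω : Set R3)} {k : ℕ} {v : R3 → Fin 3 → ℝ} {d : R3 → ℝ}

theorem IsWeakDiv.weakDiv_ae_eq [IsFiniteMeasure (volume.restrict (Ω : Set R3))]
    (h : IsWeakDiv Ω v d) (hv : v ∈ HDiv Ω) (hd : MemLp d 2 (volume.restrict (Ω : Set R3))) :
    weakDiv Ω v =ᵐ[volume.restrict (Ω : Set R3)] d :=
  (weakDiv_spec hv).2.ae_eq ((weakDiv_spec hv).1.integrable one_le_two) (hd.integrable one_le_two) h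

theorem weakDiv_mem_brokenPoly (hv : v ∈ BDM (k + 1) M) : weakDiv Ω v ∈ brokenPoly k M.cells := by
  have := M.isFiniteMeasure_restrict
  obtain ⟨hd, hvd⟩ := weakDiv_spec hv.2
  refine mem_brokenPoly.2 fun T hT => ?_
  choose q hq hvq using fun j => mem_brokenPoly.1 (hv.1 j) T hT
  have hqdiff : ∀ j, ContDiff ℝ 1 (q j) := fun j => polyFun.contDiff (hq j)
  have hsub := SimplicialMesh.subset_of_mem_cells hT
  have hmem : (fun x => ∑ j, partialDeriv j (q j) x) ∈ polyFun 3 k := by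
    rw [← Finset.sum_fn]
    exact Submodule.sum_mem _ fun j _ => polyFun.fderiv_apply_mem (hq j) _
  have hqT : IsWeakDiv ⟨T, SimplicialMesh.isOpen_of_mem_cells hT⟩ (fun x j => q j x)
      (weakDiv Ω v) :=
    (hvd.mono hsub).congr ((ae_all_iff.2 hvq).mono fun x hx => funext hx)
  refine ⟨_, hmem, hqT.ae_eq ((hd.integrable one_le_two).mono_measure
    (Measure.restrict_mono hsub le_rfl)) ?_ (.of_contDiff hqdiff)⟩
  exact memLp_one_iff_integrable.1 (memLp_restrict_of_continuous
    (SimplicialMesh.isBounded_of_mem_cells hT) (polyFun.contDiff hmem (N := 0)).continuous)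

theorem RT_subset_BDM : RT k M ⊆ BDM (k + 1) M := by
  rintro v ⟨hv, hdiv⟩
  refine ⟨fun i T hT => ?_, hdiv⟩
  obtain ⟨p, q, hp, hq, hvpq⟩ := hv T hT
  refine ⟨p i + q * .X i, ?_, hvpq.mono fun x hx => by simp [hx i]⟩
  refine (MvPolynomial.totalDegree_add _ _).trans (max_le ((hp i).trans k.le_succ) ?_)
  refine (MvPolynomial.totalDegree_mul _ _).trans ?_
  rw [MvPolynomial.totalDegree_X]
  exact Nat.add_le_add_right hq.totalDegree_le 1

theorem brokenPolyV_subset_L2V : brokenPolyV k M.cells ⊆ L2V Ω :=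
  fun _ hv i => memLp_two_of_mem_brokenPoly (hv i)

end DiscreteSpaces

section LengthScale

/-- The vector field `((∇ℓ)·ω)_i = ∑_j (∂_j ℓ) ω_ij`, the lower-order term in
`∇·(ℓω) = ℓ ∇·ω + (∇ℓ)·ω`. -/
def gradMul (ℓ : R3 → ℝ) (ω : R3 → Mat) : R3 → Fin 3 → ℝ :=
  fun x i => ∑ j, partialDeriv j ℓ x * ω x i j

theorem sum_sq_partialDeriv (f : R3 → ℝ) (x : R3) :
    ∑ j, partialDeriv j f x ^ 2 = ‖gradient f x‖ ^ 2 := by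
  rw [EuclideanSpace.norm_sq_eq]
  refine Finset.sum_congr rfl fun j _ => ?_
  rw [Real.norm_eq_abs, sq_abs, partialDeriv, gradient,
    ← InnerProductSpace.toDual_symm_apply (y := fderiv ℝ f x), EuclideanSpace.inner_single_right,
    conj_trivial, one_mul]

namespace IsLengthScale

variable {Ω : Opens R3} {ℓ : R3 → ℝ} {Cl : ℝ} {M : SimplicialMesh (Ω : Set R3)}
  {f : R3 → ℝ} {v : R3 → Fin 3 → ℝ} {ω : R3 → Mat} {Θ : Set (Set R3)}

theorem of_resolves (hℓ : IsLengthScale Ω Θ ℓ Cl) (hM : M.Resolves Θ) :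
    IsLengthScale Ω M.cells ℓ Cl :=
  ⟨⟨brokenPoly_anti hM hℓ.mem.1, hℓ.mem.2⟩, hℓ.bounds, hℓ.gradient_le⟩

theorem memLp_mul (hℓ : IsLengthScale Ω Θ ℓ Cl) (hf : MemLp f 2 (volume.restrict (Ω : Set R3))) :
    MemLp (fun x => ℓ x * f x) 2 (volume.restrict (Ω : Set R3)) := by
  refine hf.mul (memLp_top_of_bound
    (hℓ.mem.2.aestronglyMeasurable Ω.isOpen.measurableSet) 1 ?_)
  filter_upwards [hℓ.bounds] with x hx
  rw [Real.norm_eq_abs, abs_of_nonneg hx.1]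
  exact hx.2

theorem sum_sq_partialDeriv_le (hℓ : IsLengthScale Ω Θ ℓ Cl) :
    ∀ᵐ x ∂volume.restrict (Ω : Set R3), ∑ j, partialDeriv j ℓ x ^ 2 ≤ Cl ^ 2 := by
  filter_upwards [hℓ.gradient_le] with x hx
  rw [sum_sq_partialDeriv]
  exact pow_le_pow_left₀ (norm_nonneg _) hx 2

theorem memLp_sum_partialDeriv_mul (hℓ : IsLengthScale Ω Θ ℓ Cl) (hv : v ∈ L2V Ω) :
    MemLp (fun x => ∑ j, partialDeriv j ℓ x * v x j) 2 (volume.restrict (Ω : Set R3)) := by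
  refine memLp_finsetSum _ fun j _ => (hv j).mul (memLp_top_of_bound
    (measurable_partialDeriv j ℓ).aestronglyMeasurable |Cl| ?_)
  filter_upwards [hℓ.sum_sq_partialDeriv_le] with x hx
  exact sq_le_sq.1 ((Finset.single_le_sum (fun i _ => sq_nonneg (partialDeriv i ℓ x))
    (Finset.mem_univ j)).trans hx)

theorem isWeakDiv_smul (hℓ : IsLengthScale Ω M.cells ℓ Cl) (hv : v ∈ HDiv Ω) :
    IsWeakDiv Ω (fun x => ℓ x • v x) fun x =>
      ℓ x * weakDiv Ω v x + ∑ j, partialDeriv j ℓ x * v x j :=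
  have := M.isFiniteMeasure_restrict
  (weakDiv_spec hv).2.mul (fun j => (hv.1 j).integrable one_le_two)
    ((weakDiv_spec hv).1.integrable one_le_two)
    (locallyLipschitzOn_of_mem_contPoly Ω.isOpen hℓ.mem)

theorem memLp_weakDiv_smul (hℓ : IsLengthScale Ω Θ ℓ Cl) (hv : v ∈ HDiv Ω) :
    MemLp (fun x => ℓ x * weakDiv Ω v x + ∑ j, partialDeriv j ℓ x * v x j) 2
      (volume.restrict (Ω : Set R3)) :=
  (hℓ.memLp_mul (weakDiv_spec hv).1).add (hℓ.memLp_sum_partialDeriv_mul hv.1)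

theorem smul_mem_L2V (hℓ : IsLengthScale Ω Θ ℓ Cl) (hv : v ∈ L2V Ω) :
    (fun x => ℓ x • v x) ∈ L2V Ω :=
  fun j => hℓ.memLp_mul (hv j)

theorem smul_mem_HDiv (hℓ : IsLengthScale Ω M.cells ℓ Cl) (hv : v ∈ HDiv Ω) :
    (fun x => ℓ x • v x) ∈ HDiv Ω :=
  ⟨hℓ.smul_mem_L2V hv.1, _, hℓ.memLp_weakDiv_smul hv, hℓ.isWeakDiv_smul hv⟩

theorem divM_scale_ae_eq (hℓ : IsLengthScale Ω M.cells ℓ Cl) (hω : ω ∈ HDivM Ω) :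
    ∀ᵐ x ∂volume.restrict (Ω : Set R3),
      divM Ω (scale ℓ ω) x = ℓ x • divM Ω ω x + gradMul ℓ ω x := by
  have := M.isFiniteMeasure_restrict
  have hrow := ae_all_iff.2 fun i => (hℓ.isWeakDiv_smul (hω i)).weakDiv_ae_eq
    (hℓ.smul_mem_HDiv (hω i)) (hℓ.memLp_weakDiv_smul (hω i))
  exact hrow.mono fun x hx => funext hx

theorem gradMul_mem_L2V (hℓ : IsLengthScale Ω Θ ℓ Cl) (hω : ω ∈ L2M Ω) : gradMul ℓ ω ∈ L2V Ω :=
  fun i => hℓ.memLp_sum_partialDeriv_mul (hω i)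

theorem sum_sq_gradMul_le (hℓ : IsLengthScale Ω Θ ℓ Cl) (ω : R3 → Mat) :
    ∀ᵐ x ∂volume.restrict (Ω : Set R3),
      ∑ i, gradMul ℓ ω x i ^ 2 ≤ Cl ^ 2 * ∑ i, ∑ j, ω x i j ^ 2 := by
  filter_upwards [hℓ.sum_sq_partialDeriv_le] with x hx
  rw [Finset.mul_sum]
  exact Finset.sum_le_sum fun i _ => (Finset.sum_mul_sq_le_sq_mul_sq _ _ _).trans
    (mul_le_mul_of_nonneg_right hx (Finset.sum_nonneg fun j _ => sq_nonneg _))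

end IsLengthScale

end LengthScale

/-! ### Coercivity on the discrete kernel -/

section InnerProduct

variable {Ω : Set R3} {u v w : R3 → Fin 3 → ℝ} {σ : R3 → Mat} {c C : ℝ}

theorem integrable_sum_mul (hu : u ∈ L2V Ω) (hv : v ∈ L2V Ω) :
    IntegrableOn (fun x => ∑ i, u x i * v x i) Ω :=
  integrable_finsetSum _ fun i _ => (hu i).integrable_mul (hv i)

theorem innerV_eq_sum (hu : u ∈ L2V Ω) (hv : v ∈ L2V Ω) :
    innerV Ω u v = ∑ i, ∫ x in Ω, u x i * v x i :=
  integral_finsetSum _ fun i _ => (hu i).integrable_mul (hv i)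

theorem innerV_sub_left (hu : u ∈ L2V Ω) (hv : v ∈ L2V Ω) (hw : w ∈ L2V Ω) :
    innerV Ω (fun x => u x - v x) w = innerV Ω u w - innerV Ω v w := by
  rw [innerV, innerV, innerV, ← integral_sub (integrable_sum_mul hu hw) (integrable_sum_mul hv hw)]
  simp only [Pi.sub_apply, sub_mul, Finset.sum_sub_distrib]

theorem innerM_self_nonneg (Ω : Set R3) (σ : R3 → Mat) : 0 ≤ innerM Ω σ σ :=
  integral_nonneg fun _ => Finset.sum_nonneg fun _ _ => Finset.sum_nonneg fun _ _ =>
    mul_self_nonneg _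

theorem innerV_self_le_of_le_mul_innerV (hu : u ∈ L2V Ω) (hv : v ∈ L2V Ω)
    (h : innerV Ω v v ≤ C * innerV Ω u v) : innerV Ω v v ≤ C ^ 2 * innerV Ω u u := by
  have hexpand : ∫ x in Ω, ∑ i, (C * u x i - v x i) ^ 2 =
      C ^ 2 * innerV Ω u u - 2 * C * innerV Ω u v + innerV Ω v v := by
    have huu := (integrable_sum_mul hu hu).const_mul (C ^ 2)
    have huv := (integrable_sum_mul hu hv).const_mul (2 * C)
    have hsum := integral_add (huu.sub huv) (integrable_sum_mul hv hv)
    rw [integral_sub' huu huv, integral_const_mul, integral_const_mul] at hsum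
    refine Eq.trans (integral_congr_ae (.of_forall fun x => ?_)) hsum
    simp only [Pi.sub_apply, Finset.mul_sum, ← Finset.sum_sub_distrib, ← Finset.sum_add_distrib]
    exact Finset.sum_congr rfl fun i _ => by ring
  have hnonneg : 0 ≤ ∫ x in Ω, ∑ i, (C * u x i - v x i) ^ 2 :=
    integral_nonneg fun x => Finset.sum_nonneg fun i _ => sq_nonneg _
  linarith

theorem innerV_self_le_two_mul_add (hu : u ∈ L2V Ω) (hv : v ∈ L2V Ω)
    (h : ∀ᵐ x ∂volume.restrict Ω, ∀ i, w x i ^ 2 ≤ 2 * (u x i ^ 2 + v x i ^ 2)) :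
    innerV Ω w w ≤ 2 * (innerV Ω u u + innerV Ω v v) := by
  have huu := integrable_sum_mul hu hu
  have hvv := integrable_sum_mul hv hv
  simp only [innerV, ← sq] at huu hvv ⊢
  rw [← integral_add huu hvv, ← integral_const_mul]
  refine integral_mono_of_nonneg (.of_forall fun x => Finset.sum_nonneg fun i _ => sq_nonneg _)
    ((huu.add hvv).const_mul 2) ?_
  filter_upwards [h] with x hx
  rw [← Finset.sum_add_distrib, Finset.mul_sum]
  exact Finset.sum_le_sum fun i _ => hx i

theorem innerV_self_le_mul_innerM_self (hσ : σ ∈ L2M Ω)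
    (h : ∀ᵐ x ∂volume.restrict Ω, ∑ i, u x i ^ 2 ≤ c * ∑ i, ∑ j, σ x i j ^ 2) :
    innerV Ω u u ≤ c * innerM Ω σ σ := by
  have hσσ : IntegrableOn (fun x => ∑ i, ∑ j, σ x i j * σ x i j) Ω :=
    integrable_finsetSum _ fun i _ => integrable_sum_mul (hσ i) (hσ i)
  simp only [innerV, innerM, ← sq] at hσσ ⊢
  rw [← integral_const_mul]
  exact integral_mono_of_nonneg (.of_forall fun x => Finset.sum_nonneg fun i _ => sq_nonneg _)
    (hσσ.const_mul c) h

theorem asym_mem_L2V (hσ : σ ∈ L2M Ω) : (fun x => asym (σ x)) ∈ L2V Ω :=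
  fun i => (hσ (i - 1) (i + 1)).sub (hσ (i + 1) (i - 1))

theorem sum_sq_asym_le (m : Mat) : ∑ i, asym m i ^ 2 ≤ 2 * ∑ i, ∑ j, m i j ^ 2 := by
  have hindex : (∀ i : Fin 3, asym m i = m (i - 1) (i + 1) - m (i + 1) (i - 1)) := fun _ => rfl
  simp only [hindex, Fin.sum_univ_three, Fin.reduceSub, Fin.reduceAdd]
  nlinarith [sq_nonneg (m 2 1 + m 1 2), sq_nonneg (m 0 2 + m 2 0), sq_nonneg (m 1 0 + m 0 1),
    sq_nonneg (m 0 0), sq_nonneg (m 1 1), sq_nonneg (m 2 2)]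

end InnerProduct

section Kernel

variable {Ω : Opens R3} {M : SimplicialMesh (Ω : Set R3)} {ℓ : R3 → ℝ} {Cl : ℝ} {k : ℕ}
  {W : Set (R3 → Fin 3 → ℝ)} {p : (R3 → Mat) × (R3 → Mat)} {r : R3 → Fin 3 → ℝ}

theorem zero_mem_brokenPolyV {𝒯 : Set (Set R3)} : (0 : R3 → Fin 3 → ℝ) ∈ brokenPolyV k 𝒯 :=
  fun _ _ _ => ⟨0, by simp, .of_forall fun _ => by simp⟩

theorem Xp_mono {W' : Set (R3 → Fin 3 → ℝ)} (h : W ⊆ W') : Xp k M W ⊆ Xp k M W' :=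
  fun _ hp => ⟨hp.1, fun i => h (hp.2 i)⟩

theorem discreteKernel_mono {W' : Set (R3 → Fin 3 → ℝ)} (h : W ⊆ W') :
    discreteKernel ℓ k M W ⊆ discreteKernel ℓ k M W' :=
  fun _ hp => ⟨Xp_mono h hp.1, hp.2⟩

theorem innerV_opS_fst_eq_zero (hp : p ∈ discreteKernel ℓ k M W) (hr : r ∈ brokenPolyV k M.cells) :
    innerV Ω (opS Ω ℓ p).1 r = 0 := by
  simpa [formS, innerV] using hp.2 (r, 0) ⟨hr, zero_mem_brokenPolyV⟩

theorem innerV_opS_snd_eq_zero (hp : p ∈ discreteKernel ℓ k M W) (hr : r ∈ brokenPolyV k M.cells) :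
    innerV Ω (opS Ω ℓ p).2 r = 0 := by
  simpa [formS, innerV] using hp.2 (0, r) ⟨zero_mem_brokenPolyV, hr⟩

theorem divM_mem_brokenPolyV {σ : R3 → Mat} (hσ : σ ∈ rows (BDM (k + 1) M)) :
    divM Ω σ ∈ brokenPolyV k M.cells :=
  fun i => weakDiv_mem_brokenPoly (hσ i)

theorem innerV_divM_fst_eq_zero (hp : p ∈ discreteKernel ℓ k M W) :
    innerV Ω (divM Ω p.1) (divM Ω p.1) = 0 := by
  have h := innerV_opS_fst_eq_zero hp (divM_mem_brokenPolyV hp.1.1)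
  simpa [innerV, opS, integral_neg] using h

theorem exists_brokenPolyV_majorant (k : ℕ) : ∃ C, 0 < C ∧
    ∀ {Ω : Opens R3} {M : SimplicialMesh (Ω : Set R3)} {ℓ : R3 → ℝ} {Cl : ℝ},
      IsLengthScale Ω M.cells ℓ Cl →
      ∃ μ : R3 → ℝ, (∀ᵐ x ∂volume.restrict (Ω : Set R3), ℓ x ≤ μ x) ∧
        ∀ v ∈ brokenPolyV k M.cells, (fun x => μ x • v x) ∈ brokenPolyV k M.cells ∧
          innerV Ω (fun x => μ x • v x) (fun x => μ x • v x) ≤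
            C * innerV Ω (fun x => ℓ x • v x) (fun x => μ x • v x) := by
  obtain ⟨C, hC, hbound⟩ := exists_brokenPoly_majorant k
  refine ⟨C, hC, fun {Ω M ℓ Cl} hℓ => ?_⟩
  obtain ⟨μ, hμ, hle, hμbound⟩ := hbound hℓ.mem.1 (hℓ.bounds.mono fun x hx => hx.1)
  refine ⟨μ, hle, fun v hv => ?_⟩
  have hμv : (fun x => μ x • v x) ∈ brokenPolyV k M.cells := fun i => by
    have h := mul_mem_brokenPoly hμ (hv i)
    rwa [zero_add] at h
  refine ⟨hμv, ?_⟩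
  rw [innerV_eq_sum (brokenPolyV_subset_L2V hμv) (brokenPolyV_subset_L2V hμv),
    innerV_eq_sum (hℓ.smul_mem_L2V (brokenPolyV_subset_L2V hv)) (brokenPolyV_subset_L2V hμv),
    Finset.mul_sum]
  refine Finset.sum_le_sum fun i _ => ?_
  have h := hμbound _ (hv i)
  simp only [sq] at h
  exact h

theorem asym_sub_gradMul_mem_L2V {σ ω : R3 → Mat} (hℓ : IsLengthScale Ω M.cells ℓ Cl)
    (hσ : σ ∈ L2M Ω) (hω : ω ∈ L2M Ω) : (fun x => asym (σ x) - gradMul ℓ ω x) ∈ L2V Ω :=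
  fun i => (asym_mem_L2V hσ i).sub (hℓ.gradMul_mem_L2V hω i)

theorem innerV_smul_divM_eq (hℓ : IsLengthScale Ω M.cells ℓ Cl)
    (hp : p ∈ discreteKernel ℓ k M (BDM (k + 1) M)) (hr : r ∈ brokenPolyV k M.cells) :
    innerV Ω (fun x => ℓ x • divM Ω p.2 x) r =
      innerV Ω (fun x => asym (p.1 x) - gradMul ℓ p.2 x) r := by
  have hω : p.2 ∈ HDivM Ω := fun i => (hp.1.2 i).2
  have hdiff : (fun x => asym (p.1 x) - gradMul ℓ p.2 x) ∈ L2V Ω :=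
    asym_sub_gradMul_mem_L2V hℓ (fun i => (hp.1.1 i).2.1) fun i => (hω i).1
  have hdiv : (fun x => ℓ x • divM Ω p.2 x) ∈ L2V Ω :=
    hℓ.smul_mem_L2V fun i => (weakDiv_spec (hω i)).1
  have hsplit : innerV Ω (opS Ω ℓ p).2 r = innerV Ω
      (fun x => (asym (p.1 x) - gradMul ℓ p.2 x) - ℓ x • divM Ω p.2 x) r := by
    refine integral_congr_ae ((hℓ.divM_scale_ae_eq hω).mono fun x hx => ?_)
    simp only [opS, hx]
    exact Finset.sum_congr rfl fun i _ => by simp only [Pi.sub_apply, Pi.add_apply]; ring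
  rw [innerV_opS_snd_eq_zero hp hr, innerV_sub_left hdiff hdiv (brokenPolyV_subset_L2V hr)]
    at hsplit
  exact (sub_eq_zero.1 hsplit.symm).symm

theorem innerV_divM_scale_le {σ : R3 → Mat} {μ : R3 → ℝ} (hℓ : IsLengthScale Ω M.cells ℓ Cl)
    (hσ : σ ∈ HDivM Ω) (hle : ∀ᵐ x ∂volume.restrict (Ω : Set R3), ℓ x ≤ μ x)
    (hμ : (fun x => μ x • divM Ω σ x) ∈ L2V Ω) :
    innerV Ω (divM Ω (scale ℓ σ)) (divM Ω (scale ℓ σ)) ≤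
      2 * (innerV Ω (fun x => μ x • divM Ω σ x) (fun x => μ x • divM Ω σ x) +
        innerV Ω (gradMul ℓ σ) (gradMul ℓ σ)) := by
  refine innerV_self_le_two_mul_add hμ (hℓ.gradMul_mem_L2V fun i => (hσ i).1) ?_
  filter_upwards [hℓ.divM_scale_ae_eq hσ, hle, hℓ.bounds] with x hx hleμ hℓx i
  have hsq : (ℓ x * divM Ω σ x i) ^ 2 ≤ (μ x * divM Ω σ x i) ^ 2 := by
    rw [mul_pow, mul_pow]
    exact mul_le_mul_of_nonneg_right (pow_le_pow_left₀ hℓx.1 hleμ 2) (sq_nonneg _)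
  simp only [hx, Pi.add_apply, Pi.smul_apply, smul_eq_mul]
  exact add_sq_le.trans (by linarith)

theorem innerV_asym_sub_gradMul_le {σ ω : R3 → Mat} (hℓ : IsLengthScale Ω M.cells ℓ Cl)
    (hσ : σ ∈ L2M Ω) (hω : ω ∈ L2M Ω) :
    innerV Ω (fun x => asym (σ x) - gradMul ℓ ω x) (fun x => asym (σ x) - gradMul ℓ ω x) ≤
      2 * (2 * innerM Ω σ σ + Cl ^ 2 * innerM Ω ω ω) := by
  have hasym := innerV_self_le_mul_innerM_self hσ (.of_forall fun x => sum_sq_asym_le (σ x))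
  have hgrad := innerV_self_le_mul_innerM_self hω (hℓ.sum_sq_gradMul_le ω)
  refine (innerV_self_le_two_mul_add (asym_mem_L2V hσ) (hℓ.gradMul_mem_L2V hω)
    (.of_forall fun x i => ?_)).trans (by gcongr)
  rw [Pi.sub_apply, sub_eq_add_neg, ← neg_sq (gradMul ℓ ω x i)]
  exact add_sq_le

theorem exists_innerV_divM_scale_le (k : ℕ) (Cl : ℝ) : ∃ K, 0 < K ∧
    ∀ {Ω : Opens R3} {M : SimplicialMesh (Ω : Set R3)} {ℓ : R3 → ℝ}
      {p : (R3 → Mat) × (R3 → Mat)}, IsLengthScale Ω M.cells ℓ Cl →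
      p ∈ discreteKernel ℓ k M (BDM (k + 1) M) →
      innerV Ω (divM Ω (scale ℓ p.2)) (divM Ω (scale ℓ p.2)) ≤
        K * (innerM Ω p.1 p.1 + innerM Ω p.2 p.2) := by
  obtain ⟨C, hC, hmajorant⟩ := exists_brokenPolyV_majorant k
  refine ⟨8 * C ^ 2 + (4 * C ^ 2 + 2) * Cl ^ 2, by positivity, fun {Ω M ℓ p} hℓ hp => ?_⟩
  have hσ : p.1 ∈ L2M Ω := fun i => (hp.1.1 i).2.1
  have hω : p.2 ∈ L2M Ω := fun i => (hp.1.2 i).2.1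
  obtain ⟨μ, hle, hμ⟩ := hmajorant hℓ
  obtain ⟨hr, htest⟩ := hμ _ (divM_mem_brokenPolyV hp.1.2)
  rw [innerV_smul_divM_eq hℓ hp hr] at htest
  have hr_le := innerV_self_le_of_le_mul_innerV (asym_sub_gradMul_mem_L2V hℓ hσ hω)
    (brokenPolyV_subset_L2V hr) htest
  have hσ_nonneg := innerM_self_nonneg Ω p.1
  have hω_nonneg := innerM_self_nonneg Ω p.2
  calc innerV Ω (divM Ω (scale ℓ p.2)) (divM Ω (scale ℓ p.2))
      ≤ 2 * (C ^ 2 * (2 * (2 * innerM Ω p.1 p.1 + Cl ^ 2 * innerM Ω p.2 p.2)) +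
        Cl ^ 2 * innerM Ω p.2 p.2) := by
        refine (innerV_divM_scale_le hℓ (fun i => (hp.1.2 i).2) hle
          (brokenPolyV_subset_L2V hr)).trans ?_
        gcongr
        · exact hr_le.trans (by gcongr; exact innerV_asym_sub_gradMul_le hℓ hσ hω)
        · exact innerV_self_le_mul_innerM_self hω (hℓ.sum_sq_gradMul_le p.2)
    _ ≤ (8 * C ^ 2 + (4 * C ^ 2 + 2) * Cl ^ 2) * (innerM Ω p.1 p.1 + innerM Ω p.2 p.2) := by
        have hσ_term : 0 ≤ (4 * C ^ 2 + 2) * Cl ^ 2 * innerM Ω p.1 p.1 := by positivity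
        have hω_term : 0 ≤ 8 * C ^ 2 * innerM Ω p.2 p.2 := by positivity
        linarith

end Kernel

section Coercivity

variable {Ω : Opens R3} {M : SimplicialMesh (Ω : Set R3)} {ℓ : R3 → ℝ} {Cl : ℝ} {k : ℕ}

theorem IsLengthScale.Xp_subset_HlM (hℓ : IsLengthScale Ω M.cells ℓ Cl) :
    Xp k M (BDM (k + 1) M) ⊆ HlM Ω ℓ :=
  fun _ hp => ⟨fun i => (hp.1 i).2, fun i => (hp.2 i).2.1, fun i => hℓ.smul_mem_HDiv (hp.2 i).2⟩

theorem exists_normSqHlM_le (k : ℕ) (Cl : ℝ) : ∃ K, 0 < K ∧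
    ∀ {Ω : Opens R3} {M : SimplicialMesh (Ω : Set R3)} {ℓ : R3 → ℝ}
      {p : (R3 → Mat) × (R3 → Mat)}, IsLengthScale Ω M.cells ℓ Cl →
      p ∈ discreteKernel ℓ k M (BDM (k + 1) M) →
      normSqHlM Ω ℓ p ≤ K * (innerM Ω p.1 p.1 + innerM Ω p.2 p.2) := by
  obtain ⟨K, hK, hdiv⟩ := exists_innerV_divM_scale_le k Cl
  refine ⟨1 + K, by positivity, fun {Ω M ℓ p} hℓ hp => ?_⟩
  have hdiv_le := hdiv hℓ hp
  rw [normSqHlM, innerV_divM_fst_eq_zero hp]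
  linarith

theorem min_mul_le_formA {Aσ Aω : FourTensorField} {aσ aω : ℝ} {p : (R3 → Mat) × (R3 → Mat)}
    (hσ : aσ * innerM Ω p.1 p.1 ≤ innerM Ω (Aσ.app p.1) p.1)
    (hω : aω * innerM Ω p.2 p.2 ≤ innerM Ω (Aω.app p.2) p.2) :
    min aσ aω * (innerM Ω p.1 p.1 + innerM Ω p.2 p.2) ≤ formA Ω Aσ Aω p p := by
  rw [mul_add, formA]
  exact add_le_add
    ((mul_le_mul_of_nonneg_right (min_le_left _ _) (innerM_self_nonneg Ω p.1)).trans hσ)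
    ((mul_le_mul_of_nonneg_right (min_le_right _ _) (innerM_self_nonneg Ω p.2)).trans hω)

end Coercivity

end Cosserat

end

open Cosserat in
theorem lemma4p6_general (k : ℕ) (Cl : ℝ) :
    ∃ C : ℝ, 0 < C ∧
      ∀ (Ω : TopologicalSpace.Opens R3) (Aσ Aω : FourTensorField) (aσ aω : ℝ), 0 ≤ aσ → 0 ≤ aω →
        (∀ τ ∈ L2M Ω, aσ * innerM Ω τ τ ≤ innerM Ω (Aσ.app τ) τ) →
        (∀ τ ∈ L2M Ω, aω * innerM Ω τ τ ≤ innerM Ω (Aω.app τ) τ) →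
      ∀ (M : SimplicialMesh (Ω : Set R3)) (ℓ : R3 → ℝ), IsLengthScale Ω M.cells ℓ Cl →
      ∀ W ⊆ BDM (k + 1) M,
        Xp k M W ⊆ HlM Ω ℓ ∧ Xu k M ⊆ L2V Ω ×ˢ L2V Ω ∧
        ∀ p ∈ discreteKernel ℓ k M W,
          C * min aσ aω * normSqHlM Ω ℓ p ≤ formA Ω Aσ Aω p p := by
  obtain ⟨K, hK, hnorm⟩ := exists_normSqHlM_le k Cl
  refine ⟨K⁻¹, inv_pos.2 hK, fun Ω Aσ Aω aσ aω haσ haω hAσ hAω M ℓ hℓ W hW => ⟨?_, ?_, ?_⟩⟩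
  · exact (Xp_mono hW).trans hℓ.Xp_subset_HlM
  · exact prod_mono brokenPolyV_subset_L2V brokenPolyV_subset_L2V
  · intro p hp
    have hpHlM := hℓ.Xp_subset_HlM (discreteKernel_mono hW hp).1
    calc K⁻¹ * min aσ aω * normSqHlM Ω ℓ p = min aσ aω * (K⁻¹ * normSqHlM Ω ℓ p) := by ring
      _ ≤ min aσ aω * (innerM Ω p.1 p.1 + innerM Ω p.2 p.2) :=
        mul_le_mul_of_nonneg_left ((inv_mul_le_iff₀ hK).2 (hnorm hℓ (discreteKernel_mono hW hp)))
          (le_min haσ haω)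
      _ ≤ formA Ω Aσ Aω p p :=
        min_mul_le_formA (hAσ _ fun i => (hpHlM.1 i).1) (hAω _ hpHlM.2.1)

theorem lemma4p6 (k : ℕ) (Cl : ℝ) :
    ∃ C : ℝ, 0 < C ∧
      ∀ (Ω : TopologicalSpace.Opens Cosserat.R3),
        Bornology.IsBounded (Ω : Set Cosserat.R3) → ContractibleSpace Ω →
      ∀ (Aσ Aω : Cosserat.FourTensorField) (aσ bσ aω bω : ℝ),
        Cosserat.IsMaterialTensor Ω Aσ aσ bσ → Cosserat.IsMaterialTensor Ω Aω aω bω →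
      ∀ (Θ : Set (Set Cosserat.R3)) (ℓ : Cosserat.R3 → ℝ),
        Cosserat.IsPartition Ω Θ → Cosserat.IsLengthScale Ω Θ ℓ Cl →
      ∀ M : Cosserat.SimplicialMesh (Ω : Set Cosserat.R3), M.Resolves Θ →
      ∀ W : Set (Cosserat.R3 → Fin 3 → ℝ),
        (W = Cosserat.BDM (k + 1) M ∨ W = Cosserat.RT k M) →
        Cosserat.Xp k M W ⊆ Cosserat.HlM Ω ℓ ∧
        Cosserat.Xu k M ⊆ Cosserat.L2V Ω ×ˢ Cosserat.L2V Ω ∧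
        ∀ p ∈ Cosserat.discreteKernel ℓ k M W,
          C * min aσ aω * Cosserat.normSqHlM Ω ℓ p ≤ Cosserat.formA Ω Aσ Aω p p := by
  obtain ⟨C, hC, hgeneral⟩ := lemma4p6_general k Cl
  refine ⟨C, hC, fun Ω _ _ Aσ Aω aσ _ aω _ hσ hω Θ ℓ _ hℓ M hM W hW => ?_⟩
  exact hgeneral Ω Aσ Aω aσ aω hσ.lo_pos.le hω.lo_pos.le hσ.lower hω.lower M ℓ (hℓ.of_resolves hM)
    W (hW.elim Eq.subset fun h => h ▸ Cosserat.RT_subset_BDM)
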